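/- **Setting.** Let $\{\mathbf Y_t\}_{t\in\mathbb Z}$ be a process of integrable $\mathbb R^d$-valued random vectors on a probability space, let $\mathcal F_t=\sigma(\mathbf Y_s: s\le t)$, let $\Theta\subset\mathbb R^m$, and let $\lambda:(\mathbb R^d)^{\mathbb N}\times\Theta\to\mathbb R^d$ and $\mathbf W:(\mathbb R^d)^{\mathbb N}\to\mathbb R^{d\times d}$ be measurable. Put $$\boldsymbol\lambda_t(\boldsymbol\theta)=\lambda(\mathbf Y_{t-1},\mathbf Y_{t-2},\dots;\boldsymbol\theta),\qquad \mathbf W_t=\mathbf W(\mathbf Y_{t-1},\mathbf Y_{t-2},\dots),$$ and suppose that the conditional mean is correctly specified: for some $\boldsymbol\theta_0\in\Theta$, $\mathrm E(\mathbf Y_t\mid\mathcal F_{t-1})=\boldsymbol\lambda_t(\boldsymbol\theta_0)$ a.s. for all $t\in\mathbb Z$. Let $$l_t(\boldsymbol\theta,\mathbf W_t)=(\mathbf Y_t-\boldsymbol\lambda_t(\boldsymbol\theta))'\,\mathbf W_t\,(\mathbf Y_t-\boldsymbol\lambda_t(\boldsymbol\theta)),\qquad L_T(\boldsymbol\theta,\mathbf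 W)=\frac1T\sum_{t=1}^T l_t(\boldsymbol\theta,\mathbf W_t),$$ and, for each $T\ge1$, let the first-step multivariate weighted least squares estimator $\hat{\boldsymbol\theta}_1=\hat{\boldsymbol\theta}_{1,T}$ be a random vector that a.s. lies in $\Theta$ and minimizes $L_T(\cdot,\mathbf W)$ over $\Theta$. Let $$\mathbf s_t(\boldsymbol\theta,\mathbf W_t)=\Big(\frac{\partial\boldsymbol\lambda_t(\boldsymbol\theta)}{\partial\boldsymbol\theta'}\Big)'\mathbf W_t(\mathbf Y_t-\boldsymbol\lambda_t(\boldsymbol\theta))=-\tfrac12\,\frac{\partial l_t(\boldsymbol\theta,\mathbf W_t)}{\partial\boldsymbol\theta},$$ where $\partial\boldsymbol\lambda_t/\partial\boldsymbol\theta'$ is the $d\times m$ Jacobian matrix. **Assumptions.** - **A1.** $\{\mathbf Y_t\}_{t\in\mathbb Z}$ is strictly stationary and ergodic. - **A2.** For all $t$, $\boldsymbol\lambda_t(\cdot)$ is a.s. continuous on $\Theta$; $\Theta$ is compact; and $\mathrm E\sup_{\boldsymbol\theta\in\Theta}|l_t(\boldsymbol\theta,\mathbf W_t)|<\infty$. -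 **A3.** For all $t$, $\mathbf W_t$ is a.s. symmetric positive definite. - **A4.** For all $t$ and all $\boldsymbol\theta\in\Theta$: $\boldsymbol\lambda_t(\boldsymbol\theta)=\boldsymbol\lambda_t(\boldsymbol\theta_0)$ a.s. if and only if $\boldsymbol\theta=\boldsymbol\theta_0$. - **A5.** The matrices $\mathbf H=\mathrm E\big[\tfrac12\,\partial^2 l_t(\boldsymbol\theta_0,\mathbf W_t)/\partial\boldsymbol\theta\,\partial\boldsymbol\theta'\big]$ and $\mathbf I=\mathrm E\big[\mathbf s_t(\boldsymbol\theta_0,\mathbf W_t)\,\mathbf s_t(\boldsymbol\theta_0,\mathbf W_t)'\big]$ exist (all entries are integrable; by stationarity they do not depend on $t$), and $\mathbf H$ is positive definite. - **A6.** For all $t$, $\boldsymbol\lambda_t(\cdot)$ is a.s. twice continuously differentiable on the interior $\dot\Theta$ of $\Theta$, and $\mathrm E\sup_{\boldsymbol\theta\in\dot\Theta}\big\|\partial^2 l_t(\boldsymbol\theta,\mathbf W_t)/\partial\boldsymbol\theta\,\partial\boldsymbol\theta'\big\|<\infty$ in the spectral norm. - **A7.** $\boldsymbol\theta_0\in\dot\Theta$.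 **Theorem.** Under A1–A4, $\hat{\boldsymbol\theta}_1\to\boldsymbol\theta_0$ a.s. as $T\to\infty$. If A5–A7 also hold, then, as $T\to\infty$, $$\sqrt T\,(\hat{\boldsymbol\theta}_1-\boldsymbol\theta_0)\xrightarrow{d}N\big(\mathbf 0,\ \mathbf H^{-1}\,\mathbf I\,\mathbf H^{-1}\big).$$ -/

import Mathlib

open MeasureTheory ProbabilityTheory Filter Topology

noncomputable section

namespace MWLSE

/-- `ℝⁿ` with its Euclidean norm. -/
abbrev Vec (n : ℕ) := EuclideanSpace ℝ (Fin n)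

variable {Ω : Type*} {d m : ℕ}

/-- The time shift on two-sided sequences. -/
def shift (x : ℤ → Vec d) : ℤ → Vec d := fun t => x (t + 1)

/-- The process `Y` is strictly stationary and ergodic: its law on the space of two-sided
sequences is invariant (this is part of `Ergodic`) and ergodic under the time shift. -/
def StationaryErgodic [MeasurableSpace Ω] (μ : Measure Ω) (Y : ℤ → Ω → Vec d) : Prop :=
  Ergodic (shift (d := d)) (μ.map fun ω t => Y t ω)

/-- `𝓕_t`, the σ-field generated by `Y_s`, `s ≤ t`. -/
abbrev sigmaField (Y : ℤ → Ω → Vec d) (t : ℤ) : MeasurableSpace Ω :=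
  ⨆ s : {s : ℤ // s ≤ t}, MeasurableSpace.comap (Y s) inferInstance

/-- The sequence `(Y_{t-1}, Y_{t-2}, …)`. -/
def past (Y : ℤ → Ω → Vec d) (t : ℤ) (ω : Ω) : ℕ → Vec d := fun k => Y (t - 1 - k) ω

/-- `λ_t(θ) = λ(Y_{t-1}, Y_{t-2}, …; θ)`. -/
def condMean (Y : ℤ → Ω → Vec d) (lam : (ℕ → Vec d) → Vec m → Vec d)
    (t : ℤ) (ω : Ω) (θ : Vec m) : Vec d :=
  lam (past Y t ω) θ

/-- `W_t = W(Y_{t-1}, Y_{t-2}, …)`. -/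
def weight (Y : ℤ → Ω → Vec d) (W : (ℕ → Vec d) → Matrix (Fin d) (Fin d) ℝ)
    (t : ℤ) (ω : Ω) : Matrix (Fin d) (Fin d) ℝ :=
  W (past Y t ω)

/-- `l_t(θ, W_t) = (Y_t - λ_t(θ))' W_t (Y_t - λ_t(θ))`. -/
def loss (Y : ℤ → Ω → Vec d) (lam : (ℕ → Vec d) → Vec m → Vec d)
    (W : (ℕ → Vec d) → Matrix (Fin d) (Fin d) ℝ) (t : ℤ) (ω : Ω) (θ : Vec m) : ℝ :=
  (Y t ω - condMean Y lam t ω θ).ofLp ⬝ᵥ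
    (weight Y W t ω).mulVec (Y t ω - condMean Y lam t ω θ).ofLp

/-- `L_T(θ, W) = T⁻¹ ∑_{t=1}^T l_t(θ, W_t)`. -/
def objective (Y : ℤ → Ω → Vec d) (lam : (ℕ → Vec d) → Vec m → Vec d)
    (W : (ℕ → Vec d) → Matrix (Fin d) (Fin d) ℝ) (T : ℕ) (ω : Ω) (θ : Vec m) : ℝ :=
  (T : ℝ)⁻¹ * ∑ t ∈ Finset.Icc 1 T, loss Y lam W (t : ℤ) ω θ

/-- `θhat T` is, for every sample size `T ≥ 1`, a random vector that almost surely minimizes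
`L_T(·, W)` over `Θ`. -/
structure IsFirstStepEstimator [MeasurableSpace Ω] (μ : Measure Ω) (Y : ℤ → Ω → Vec d)
    (lam : (ℕ → Vec d) → Vec m → Vec d) (W : (ℕ → Vec d) → Matrix (Fin d) (Fin d) ℝ)
    (Θ : Set (Vec m)) (θhat : ℕ → Ω → Vec m) : Prop where
  aemeasurable : ∀ T, 1 ≤ T → AEMeasurable (θhat T) μ
  mem : ∀ T, 1 ≤ T → ∀ᵐ ω ∂μ, θhat T ω ∈ Θ
  isMinOn : ∀ T, 1 ≤ T → ∀ᵐ ω ∂μ, IsMinOn (objective Y lam W T ω) Θ (θhat T ω)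

/-- The `j`-th standard basis vector. -/
def stdVec (j : Fin m) : Vec m := EuclideanSpace.single j 1

/-- The `d × m` Jacobian matrix of a map `f : ℝᵐ → ℝᵈ` at `θ`. -/
def jacobian (f : Vec m → Vec d) (θ : Vec m) : Matrix (Fin d) (Fin m) ℝ :=
  Matrix.of fun i j => (fderiv ℝ f θ (stdVec j)) i

/-- The `m × m` matrix of second partial derivatives of `f : ℝᵐ → ℝ` at `θ`. -/
def hessian (f : Vec m → ℝ) (θ : Vec m) : Matrix (Fin m) (Fin m) ℝ :=
  Matrix.of fun i j => fderiv ℝ (fun θ' => fderiv ℝ f θ' (stdVec j)) θ (stdVec i)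

/-- The score `s_t(θ, W_t) = (∂λ_t(θ)/∂θ)' W_t (Y_t - λ_t(θ))`, a vector in `ℝᵐ`;
it equals `-1/2` times the gradient of `l_t(·, W_t)` at `θ`. -/
def score (Y : ℤ → Ω → Vec d) (lam : (ℕ → Vec d) → Vec m → Vec d)
    (W : (ℕ → Vec d) → Matrix (Fin d) (Fin d) ℝ) (t : ℤ) (ω : Ω) (θ : Vec m) : Fin m → ℝ :=
  (jacobian (condMean Y lam t ω) θ).transpose.mulVec
    ((weight Y W t ω).mulVec (Y t ω - condMean Y lam t ω θ).ofLp)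

/-- `H(θ, W) = E[½ ∂²l_t(θ, W_t)/∂θ∂θ']`, that is, minus the expected Jacobian of the score. For a
stationary process the expectation does not depend on `t`; it is written at `t = 1`. -/
def matH [MeasurableSpace Ω] (μ : Measure Ω) (Y : ℤ → Ω → Vec d)
    (lam : (ℕ → Vec d) → Vec m → Vec d) (W : (ℕ → Vec d) → Matrix (Fin d) (Fin d) ℝ)
    (θ : Vec m) : Matrix (Fin m) (Fin m) ℝ :=
  Matrix.of fun i j => ∫ ω, (1 / 2 : ℝ) * hessian (loss Y lam W 1 ω) θ i j ∂μ

/-- `I(θ, W) = E[s_t(θ, W_t) s_t(θ, W_t)']`, written at `t = 1`. -/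
def matI [MeasurableSpace Ω] (μ : Measure Ω) (Y : ℤ → Ω → Vec d)
    (lam : (ℕ → Vec d) → Vec m → Vec d) (W : (ℕ → Vec d) → Matrix (Fin d) (Fin d) ℝ)
    (θ : Vec m) : Matrix (Fin m) (Fin m) ℝ :=
  Matrix.of fun i j => ∫ ω, score Y lam W 1 ω θ i * score Y lam W 1 ω θ j ∂μ

/-- The spectral norm of a square matrix, as an extended nonnegative real. -/
def matSpectralNorm (A : Matrix (Fin m) (Fin m) ℝ) : ENNReal :=
  ‖Matrix.toEuclideanCLM (n := Fin m) (𝕜 := ℝ) A‖ₑ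

end MWLSE

end

/-! ### The pointwise ergodic theorem -/

namespace ErgodicTheory

variable {α : Type*} {τ : α → α} {f : α → ℝ}

/-- The running maximum `max (0, S₁, …, Sₙ)` of the Birkhoff sums of `f`, by recursion. -/
def birkhoffMax (τ : α → α) (f : α → ℝ) : ℕ → α → ℝ
  | 0, _ => 0
  | n + 1, x => max 0 (f x + birkhoffMax τ f n (τ x))

lemma birkhoffMax_nonneg (n : ℕ) (x : α) : 0 ≤ birkhoffMax τ f n x := by
  cases n with
  | zero => exact le_rfl
  | succ n => exact le_max_left _ _

lemma birkhoffMax_le_succ (n : ℕ) (x : α) : birkhoffMax τ f n x ≤ birkhoffMax τ f (n + 1) x := by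
  induction n generalizing x with
  | zero => exact birkhoffMax_nonneg _ _
  | succ n ih => exact max_le_max le_rfl (by linarith [ih (τ x)])

lemma birkhoffMax_mono (x : α) : Monotone fun n => birkhoffMax τ f n x :=
  monotone_nat_of_le_succ fun n => birkhoffMax_le_succ n x

lemma birkhoffSum_le_birkhoffMax (n : ℕ) (x : α) :
    birkhoffSum τ f n x ≤ birkhoffMax τ f n x := by
  induction n generalizing x with
  | zero => simp [birkhoffMax]
  | succ n ih =>
    rw [birkhoffSum_succ']
    exact le_trans (by linarith [ih (τ x)]) (le_max_right _ _)

variable [MeasurableSpace α] {ν : Measure α}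

lemma measurable_birkhoffMax (hτ : Measurable τ) (hf : Measurable f) (n : ℕ) :
    Measurable (birkhoffMax τ f n) := by
  induction n with
  | zero => exact measurable_const
  | succ n ih => exact measurable_const.max (hf.add (ih.comp hτ))

lemma integrable_birkhoffMax (hτ : MeasurePreserving τ ν ν) (hf : Integrable f ν) (n : ℕ) :
    Integrable (birkhoffMax τ f n) ν := by
  induction n with
  | zero => exact integrable_zero _ _ _
  | succ n ih => exact (integrable_zero α ℝ ν).sup (hf.add (hτ.integrable_comp_of_integrable ih))

/-- If `f` has negative mean, its Birkhoff sums are almost surely bounded above. -/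
lemma ae_exists_birkhoffSum_le [IsProbabilityMeasure ν] (hτ : Ergodic τ ν) (hfm : Measurable f)
    (hf : Integrable f ν) (hneg : ∫ x, f x ∂ν < 0) :
    ∀ᵐ x ∂ν, ∃ C : ℝ, ∀ n, birkhoffSum τ f n x ≤ C := by
  set A : Set α := {x | ∀ C : ℕ, ∃ n, (C : ℝ) ≤ birkhoffMax τ f n x} with hA
  have hAm : MeasurableSet A := by
    have : A = ⋂ C : ℕ, ⋃ n, {x | (C : ℝ) ≤ birkhoffMax τ f n x} := by
      ext x; simp [hA]
    rw [this]
    exact MeasurableSet.iInter fun C => MeasurableSet.iUnion fun n =>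
      measurableSet_le measurable_const (measurable_birkhoffMax hτ.measurable hfm n)
  have hinv : τ ⁻¹' A = A := by
    ext x
    constructor
    · intro hx C
      obtain ⟨D, hD⟩ := exists_nat_ge (C - f x)
      obtain ⟨n, hn⟩ := hx D
      exact ⟨n + 1, le_trans (by linarith) (le_max_right _ _)⟩
    · intro hx C
      obtain ⟨D, hD⟩ := exists_nat_ge (C + |f x| + 1)
      obtain ⟨n, hn⟩ := hx D
      have hf0 := abs_nonneg (f x)
      have hC : (0 : ℝ) ≤ C := C.cast_nonneg
      cases n with
      | zero => simp only [birkhoffMax] at hn; linarith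
      | succ n =>
        refine ⟨n, ?_⟩
        simp only [birkhoffMax] at hn
        rcases le_max_iff.1 hn with h | h
        · linarith
        · linarith [le_abs_self (f x)]
  rcases hτ.toPreErgodic.ae_mem_or_ae_notMem hAm hinv with h | h
  · exfalso
    have hlim : Tendsto (fun n => ∫ x, birkhoffMax τ f (n + 1) x - birkhoffMax τ f n (τ x) ∂ν)
        atTop (𝓝 (∫ x, f x ∂ν)) := by
      refine tendsto_integral_of_dominated_convergence (fun x => |f x|) (fun n => ?_) hf.abs
        (fun n => .of_forall fun x => ?_) ?_
      · exact ((measurable_birkhoffMax hτ.measurable hfm _).sub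
          ((measurable_birkhoffMax hτ.measurable hfm _).comp hτ.measurable)).aestronglyMeasurable
      · have h0 := birkhoffMax_nonneg (τ := τ) (f := f) n (τ x)
        simp only [birkhoffMax, Real.norm_eq_abs]
        rcases le_total 0 (f x + birkhoffMax τ f n (τ x)) with h1 | h1
        · rw [max_eq_right h1]; simp
        · rw [max_eq_left h1, abs_le]
          constructor <;> cases abs_cases (f x) <;> linarith
      · filter_upwards [h] with x hx
        have hx' : τ x ∈ A := by rw [← hinv] at hx; exact hx
        obtain ⟨D, hD⟩ := exists_nat_ge (-f x)
        obtain ⟨N, hN⟩ := hx' D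
        refine tendsto_const_nhds.congr' ?_
        filter_upwards [eventually_ge_atTop N] with n hn
        have := birkhoffMax_mono (τ := τ) (f := f) (τ x) hn
        simp only [birkhoffMax] at this ⊢
        rw [max_eq_right (by linarith)]; ring
    have hnn : ∀ n, 0 ≤ ∫ x, birkhoffMax τ f (n + 1) x - birkhoffMax τ f n (τ x) ∂ν := by
      intro n
      have hi := integrable_birkhoffMax hτ.toMeasurePreserving hf n
      have hi' := integrable_birkhoffMax hτ.toMeasurePreserving hf (n + 1)
      have heq : ∫ x, birkhoffMax τ f n (τ x) ∂ν = ∫ x, birkhoffMax τ f n x ∂ν := by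
        have := integral_map (μ := ν) hτ.measurable.aemeasurable (f := birkhoffMax τ f n)
          (measurable_birkhoffMax hτ.measurable hfm n).aestronglyMeasurable
        rw [hτ.map_eq] at this
        exact this.symm
      have hi'' : Integrable (fun x => birkhoffMax τ f n (τ x)) ν :=
        hτ.toMeasurePreserving.integrable_comp_of_integrable hi
      rw [integral_sub hi' hi'', heq, sub_nonneg]
      exact integral_mono hi hi' fun x => birkhoffMax_le_succ n x
    exact absurd (ge_of_tendsto' hlim hnn) (not_le.2 hneg)
  · filter_upwards [h] with x hx
    simp only [hA, Set.mem_ofPred_eq, not_forall, not_exists, not_le] at hx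
    obtain ⟨C, hC⟩ := hx
    exact ⟨C, fun n => (birkhoffSum_le_birkhoffMax n x).trans (hC n).le⟩

lemma ae_eventually_birkhoffSum_le [IsProbabilityMeasure ν] (hτ : Ergodic τ ν)
    (hfm : Measurable f) (hf : Integrable f ν) :
    ∀ᵐ x ∂ν, ∀ k : ℕ, ∀ᶠ n : ℕ in atTop,
      (n : ℝ)⁻¹ * birkhoffSum τ f n x ≤ ∫ y, f y ∂ν + 2 * (1 / ((k : ℝ) + 1)) := by
  rw [ae_all_iff]
  intro k
  set ε : ℝ := 1 / ((k : ℝ) + 1)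
  have hε : 0 < ε := Nat.one_div_pos_of_nat
  set c : ℝ := ∫ y, f y ∂ν + ε with hc
  have hneg : ∫ x, (f x - c) ∂ν < 0 := by
    rw [integral_sub hf (integrable_const _)]
    simp [hc, hε]
  filter_upwards [ae_exists_birkhoffSum_le hτ (hfm.sub_const c) (hf.sub (integrable_const _)) hneg]
    with x ⟨C, hC⟩
  have hlim : Tendsto (fun n : ℕ => (n : ℝ)⁻¹ * C) atTop (𝓝 0) := by
    simpa using (tendsto_inv_atTop_nhds_zero_nat (𝕜 := ℝ)).mul_const C
  filter_upwards [hlim.eventually_lt_const hε, eventually_gt_atTop 0] with n hn hn0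
  have h1 := hC n
  have hn' : (0 : ℝ) < n := by exact_mod_cast hn0
  have h2 : birkhoffSum τ (fun x => f x - c) n x = birkhoffSum τ f n x - n * c := by
    simp [birkhoffSum]
  rw [h2] at h1
  calc (n : ℝ)⁻¹ * birkhoffSum τ f n x ≤ (n : ℝ)⁻¹ * (n * c + C) := by gcongr; linarith
    _ = c + (n : ℝ)⁻¹ * C := by field_simp
    _ ≤ _ := by rw [hc]; linarith

/-- **Birkhoff's ergodic theorem** for an ergodic transformation. -/
theorem ae_tendsto_birkhoffAverage [IsProbabilityMeasure ν] (hτ : Ergodic τ ν)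
    (hfm : Measurable f) (hf : Integrable f ν) :
    ∀ᵐ x ∂ν, Tendsto (fun n : ℕ => (n : ℝ)⁻¹ * birkhoffSum τ f n x) atTop (𝓝 (∫ y, f y ∂ν)) := by
  filter_upwards [ae_eventually_birkhoffSum_le hτ hfm hf,
    ae_eventually_birkhoffSum_le hτ hfm.neg hf.neg] with x h1 h2
  rw [Metric.tendsto_nhds]
  intro ε hε
  obtain ⟨k, hk⟩ := exists_nat_one_div_lt (show 0 < ε / 2 by linarith)
  filter_upwards [h1 k, h2 k] with n a b
  have hneg : birkhoffSum τ (-f) n x = - birkhoffSum τ f n x := by simp [birkhoffSum]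
  rw [hneg] at b
  simp only [Pi.neg_apply, integral_neg, mul_neg] at b
  rw [Real.dist_eq, abs_lt]
  constructor <;> linarith

end ErgodicTheory

/-! ### A central limit theorem for martingale differences -/

namespace MartingaleCLT

/-- The product `∏_{j<n} (1 + i y_j)`, where the factors are replaced by `1` once the sum of
squares exceeds `C`. -/
noncomputable def stoppedProd (C : ℝ) (y : ℕ → ℝ) : ℕ → ℂ
  | 0 => 1
  | k + 1 => stoppedProd C y k +
      (y k) • (Complex.I * if ∑ j ∈ Finset.range k, y j ^ 2 ≤ C then stoppedProd C y k else 0)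

lemma stoppedProd_succ_of_le {C : ℝ} {y : ℕ → ℝ} {k : ℕ}
    (h : ∑ j ∈ Finset.range k, y j ^ 2 ≤ C) :
    stoppedProd C y (k + 1) = stoppedProd C y k * (1 + Complex.I * y k) := by
  simp only [stoppedProd, if_pos h, Complex.real_smul]
  ring

lemma stoppedProd_succ_of_not_le {C : ℝ} {y : ℕ → ℝ} {k : ℕ}
    (h : ¬ ∑ j ∈ Finset.range k, y j ^ 2 ≤ C) :
    stoppedProd C y (k + 1) = stoppedProd C y k := by
  simp [stoppedProd, if_neg h]

lemma norm_sq_one_add_I_mul (y : ℝ) : ‖1 + Complex.I * y‖ ^ 2 = 1 + y ^ 2 := by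
  rw [← Complex.normSq_eq_norm_sq, Complex.normSq_apply]
  simp
  ring

lemma norm_sq_stoppedProd_le_exp (C : ℝ) (y : ℕ → ℝ) (k : ℕ) :
    ‖stoppedProd C y k‖ ^ 2 ≤ Real.exp (∑ j ∈ Finset.range k, y j ^ 2) := by
  induction k with
  | zero => simp [stoppedProd]
  | succ k ih =>
    rw [Finset.sum_range_succ, Real.exp_add]
    by_cases h : ∑ j ∈ Finset.range k, y j ^ 2 ≤ C
    · rw [stoppedProd_succ_of_le h, norm_mul, mul_pow, norm_sq_one_add_I_mul]
      gcongr
      linarith [Real.add_one_le_exp (y k ^ 2)]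
    · rw [stoppedProd_succ_of_not_le h]
      exact ih.trans (le_mul_of_one_le_right (Real.exp_pos _).le
        (Real.one_le_exp (sq_nonneg _)))

lemma norm_sq_stoppedProd_le {C : ℝ} (hC : 0 ≤ C) (y : ℕ → ℝ) (k : ℕ) :
    ‖stoppedProd C y k‖ ^ 2 ≤ Real.exp C * (1 + ∑ j ∈ Finset.range k, y j ^ 2) := by
  induction k with
  | zero => simp [stoppedProd, hC]
  | succ k ih =>
    rw [Finset.sum_range_succ]
    by_cases h : ∑ j ∈ Finset.range k, y j ^ 2 ≤ C
    · rw [stoppedProd_succ_of_le h, norm_mul, mul_pow, norm_sq_one_add_I_mul]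
      have h0 : 0 ≤ ∑ j ∈ Finset.range k, y j ^ 2 := Finset.sum_nonneg fun _ _ => sq_nonneg _
      have h1 : ‖stoppedProd C y k‖ ^ 2 ≤ Real.exp C :=
        (norm_sq_stoppedProd_le_exp C y k).trans (Real.exp_le_exp.2 h)
      gcongr
      linarith
    · rw [stoppedProd_succ_of_not_le h]
      refine ih.trans ?_
      gcongr
      linarith [sq_nonneg (y k)]

lemma norm_ite_stoppedProd_le {C : ℝ} (hC : 0 ≤ C) (y : ℕ → ℝ) (k : ℕ) :
    ‖Complex.I * if ∑ j ∈ Finset.range k, y j ^ 2 ≤ C then stoppedProd C y k else 0‖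
      ≤ Real.exp C := by
  rw [norm_mul, Complex.norm_I, one_mul]
  split_ifs with h
  · have h1 : ‖stoppedProd C y k‖ ^ 2 ≤ Real.exp C :=
      (norm_sq_stoppedProd_le_exp C y k).trans (Real.exp_le_exp.2 h)
    have h2 : 1 ≤ Real.exp C := Real.one_le_exp hC
    exact (pow_le_pow_iff_left₀ (norm_nonneg _) (by positivity) two_ne_zero).1
      (h1.trans (by nlinarith))
  · simpa using (Real.exp_pos C).le

lemma stoppedProd_eq_prod {C : ℝ} {y : ℕ → ℝ} {n : ℕ}
    (h : ∑ j ∈ Finset.range n, y j ^ 2 ≤ C) :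
    stoppedProd C y n = ∏ j ∈ Finset.range n, (1 + Complex.I * y j) := by
  induction n with
  | zero => simp [stoppedProd]
  | succ n ih =>
    have h' : ∑ j ∈ Finset.range n, y j ^ 2 ≤ C := by
      rw [Finset.sum_range_succ] at h; linarith [sq_nonneg (y n)]
    rw [stoppedProd_succ_of_le h', ih h', Finset.prod_range_succ]

lemma norm_log_one_add_I_mul_sub_le {y : ℝ} (hy : |y| ≤ 1 / 2) :
    ‖Complex.log (1 + Complex.I * y) - (Complex.I * y + ((y ^ 2 / 2 : ℝ) : ℂ))‖ ≤ |y| ^ 3 := by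
  have hz : ‖Complex.I * (y : ℂ)‖ = |y| := by simp
  have h := Complex.norm_log_sub_logTaylor_le 2 (z := Complex.I * y) (by rw [hz]; linarith)
  have ht : Complex.logTaylor (2 + 1) (Complex.I * y)
      = Complex.I * y + ((y ^ 2 / 2 : ℝ) : ℂ) := by
    simp only [Complex.logTaylor_succ, Complex.logTaylor_zero, Pi.add_apply]
    push_cast
    have := Complex.I_sq
    linear_combination (-(y : ℂ) ^ 2 / 2) * this
  rw [ht, hz] at h
  refine h.trans ?_
  have h1 : (1 - |y|)⁻¹ ≤ 2 := by
    rw [inv_le_comm₀ (by linarith) (by norm_num)]; linarith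
  have h3 : 0 ≤ |y| ^ 3 := by positivity
  norm_num
  nlinarith [mul_le_mul_of_nonneg_left h1 h3]

/-- For a null array with convergent sums of squares,
`∏ (1 + i y_{n,j})` is asymptotic to `exp (i ∑ y_{n,j} + v / 2)`. -/
lemma tendsto_prod_one_add_I_mul {y : ℕ → ℕ → ℝ} {v : ℝ}
    (hsq : Tendsto (fun n => ∑ j ∈ Finset.range n, y n j ^ 2) atTop (𝓝 v))
    (hmax : ∀ ε > 0, ∀ᶠ n in atTop, ∀ j < n, |y n j| ≤ ε) :
    Tendsto (fun n => Complex.exp (Complex.I * ((∑ j ∈ Finset.range n, y n j : ℝ) : ℂ))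
      - (∏ j ∈ Finset.range n, (1 + Complex.I * y n j)) * ((Real.exp (-v / 2) : ℝ) : ℂ))
      atTop (𝓝 0) := by
  set r : ℕ → ℂ := fun n => ∑ j ∈ Finset.range n, (Complex.log (1 + Complex.I * y n j)
    - (Complex.I * y n j + ((y n j ^ 2 / 2 : ℝ) : ℂ))) with hr
  have hr0 : Tendsto r atTop (𝓝 0) := by
    rw [Metric.tendsto_nhds]
    intro ε hε
    set δ : ℝ := min (1 / 2) (ε / (2 * (|v| + 1))) with hδ
    have hδ0 : 0 < δ := by positivity
    filter_upwards [hmax δ hδ0,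
      hsq.eventually_lt_const (show v < |v| + 1 by linarith [le_abs_self v])] with n h1 h2
    rw [dist_zero_right]
    calc ‖r n‖ ≤ ∑ j ∈ Finset.range n, |y n j| ^ 3 := by
          refine norm_sum_le_of_le _ fun j hj => norm_log_one_add_I_mul_sub_le ?_
          exact (h1 j (Finset.mem_range.1 hj)).trans (min_le_left _ _)
      _ ≤ ∑ j ∈ Finset.range n, δ * y n j ^ 2 := by
          refine Finset.sum_le_sum fun j hj => ?_
          rw [pow_succ', sq_abs]
          exact mul_le_mul_of_nonneg_right (h1 j (Finset.mem_range.1 hj)) (sq_nonneg _)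
      _ = δ * ∑ j ∈ Finset.range n, y n j ^ 2 := by rw [Finset.mul_sum]
      _ ≤ δ * (|v| + 1) := by gcongr
      _ ≤ ε / (2 * (|v| + 1)) * (|v| + 1) := by gcongr; exact min_le_right _ _
      _ = ε / 2 := by field_simp
      _ < ε := by linarith
  have key : Tendsto (fun n => 1 - Complex.exp
      (((∑ j ∈ Finset.range n, y n j ^ 2 : ℝ) : ℂ) / 2 + r n + ((-v / 2 : ℝ) : ℂ))) atTop (𝓝 0) := by
    have h1 : Tendsto (fun n => ((∑ j ∈ Finset.range n, y n j ^ 2 : ℝ) : ℂ) / 2 + r n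
        + ((-v / 2 : ℝ) : ℂ)) atTop (𝓝 ((v : ℂ) / 2 + 0 + ((-v / 2 : ℝ) : ℂ))) :=
      ((((Complex.continuous_ofReal.tendsto v).comp hsq).div_const 2).add hr0).add_const _
    have h2 := (Complex.continuous_exp.tendsto _).comp h1
    have h3 : (v : ℂ) / 2 + 0 + ((-v / 2 : ℝ) : ℂ) = 0 := by push_cast; ring
    rw [h3, Complex.exp_zero] at h2
    simpa using h2.const_sub 1
  rw [tendsto_zero_iff_norm_tendsto_zero] at key ⊢
  refine key.congr fun n => ?_
  have hne : ∀ j, (1 + Complex.I * (y n j : ℂ)) ≠ 0 := fun j h => by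
    have := norm_sq_one_add_I_mul (y n j)
    rw [h] at this
    simp at this
    nlinarith [sq_nonneg (y n j)]
  have hprod : ∏ j ∈ Finset.range n, (1 + Complex.I * (y n j : ℂ))
      = Complex.exp (Complex.I * ((∑ j ∈ Finset.range n, y n j : ℝ) : ℂ))
        * Complex.exp (((∑ j ∈ Finset.range n, y n j ^ 2 : ℝ) : ℂ) / 2 + r n) := by
    rw [← Complex.exp_add, ← Finset.prod_congr rfl fun j _ => Complex.exp_log (hne j),
      ← Complex.exp_sum]
    congr 1
    simp only [hr, Finset.sum_sub_distrib, Finset.sum_add_distrib]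
    push_cast
    rw [Finset.mul_sum, Finset.sum_div]
    ring
  rw [hprod, Complex.ofReal_exp, mul_assoc, ← Complex.exp_add]
  conv_rhs => rw [← mul_one_sub, norm_mul]
  have : ‖Complex.exp (Complex.I * ((∑ j ∈ Finset.range n, y n j : ℝ) : ℂ))‖ = 1 := by
    rw [mul_comm]; exact Complex.norm_exp_ofReal_mul_I _
  rw [this, one_mul]

/-- If the averages of a nonnegative sequence converge, its maximal term is negligible. -/
lemma eventually_forall_lt_le_of_tendsto_average {a : ℕ → ℝ} {v : ℝ}
    (h : Tendsto (fun n : ℕ => (n : ℝ)⁻¹ * ∑ j ∈ Finset.range n, a j) atTop (𝓝 v)) :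
    ∀ ε > 0, ∀ᶠ n : ℕ in atTop, ∀ j < n, a j ≤ ε * n := by
  intro ε hε
  have h1 : Tendsto (fun n : ℕ => (n : ℝ)⁻¹ * a n) atTop (𝓝 0) := by
    have hs := (tendsto_add_atTop_iff_nat 1).2 h
    have hq : Tendsto (fun n : ℕ => ((n : ℝ) + 1) / n) atTop (𝓝 1) := by
      have := (tendsto_inv_atTop_nhds_zero_nat (𝕜 := ℝ)).const_add 1
      rw [add_zero] at this
      refine this.congr' ?_
      filter_upwards [eventually_gt_atTop 0] with n hn
      have : (n : ℝ) ≠ 0 := by positivity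
      field_simp
    have := (hs.mul hq).sub h
    rw [mul_one, sub_self] at this
    refine this.congr' ?_
    filter_upwards [eventually_gt_atTop 0] with n hn
    have : (n : ℝ) ≠ 0 := by positivity
    rw [Finset.sum_range_succ]
    push_cast
    field_simp
    ring
  obtain ⟨N, hN⟩ := eventually_atTop.1
    ((h1.eventually_lt_const hε).and (eventually_gt_atTop 0))
  have h2 : ∀ᶠ n : ℕ in atTop, ∀ j ∈ Finset.range N, a j ≤ ε * n := by
    rw [eventually_all_finset]
    intro j _
    have : Tendsto (fun n : ℕ => ε * (n : ℝ)) atTop atTop :=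
      tendsto_natCast_atTop_atTop.const_mul_atTop hε
    exact this.eventually_ge_atTop _
  filter_upwards [h2] with n hn j hj
  by_cases hjN : j < N
  · exact hn j (Finset.mem_range.2 hjN)
  · obtain ⟨h3, h4⟩ := hN j (not_lt.1 hjN)
    have hj0 : (0 : ℝ) < j := by exact_mod_cast h4
    rw [inv_mul_lt_iff₀ hj0] at h3
    have : (j : ℝ) ≤ n := by exact_mod_cast hj.le
    nlinarith

variable {Ω : Type*} {mΩ : MeasurableSpace Ω} {μ : Measure Ω} [IsProbabilityMeasure μ]

/-- A sequence that is bounded in `L²` and tends to `0` almost surely has integrals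
tending to `0`. -/
lemma tendsto_integral_zero_of_sq_bounded {Δ : ℕ → Ω → ℂ} {B : ℝ}
    (hm : ∀ n, AEStronglyMeasurable (Δ n) μ)
    (hInt : ∀ n, Integrable (fun ω => ‖Δ n ω‖ ^ 2) μ) (hB : ∀ n, ∫ ω, ‖Δ n ω‖ ^ 2 ∂μ ≤ B)
    (hlim : ∀ᵐ ω ∂μ, Tendsto (fun n => Δ n ω) atTop (𝓝 0)) :
    Tendsto (fun n => ∫ ω, Δ n ω ∂μ) atTop (𝓝 0) := by
  rw [Metric.tendsto_nhds]
  intro ε hε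
  set R : ℝ := 2 * (|B| + 1) / ε with hR
  have hR0 : 0 < R := by positivity
  have h1 : Tendsto (fun n => ∫ ω, min ‖Δ n ω‖ R ∂μ) atTop (𝓝 0) := by
    rw [← integral_zero Ω ℝ (μ := μ)]
    refine tendsto_integral_of_dominated_convergence (fun _ => R)
      (fun n => (hm n).norm.inf aestronglyMeasurable_const) (integrable_const _)
      (fun n => .of_forall fun ω => ?_) ?_
    · rw [Real.norm_of_nonneg (le_min (norm_nonneg _) hR0.le)]
      exact min_le_right _ _
    · filter_upwards [hlim] with ω hω
      simpa [hR0.le] using (hω.norm).min (tendsto_const_nhds (x := R))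
  filter_upwards [h1.eventually_lt_const (half_pos hε)] with n hn
  rw [dist_zero_right]
  have hmin : Integrable (fun ω => min ‖Δ n ω‖ R) μ :=
    Integrable.of_bound ((hm n).norm.inf aestronglyMeasurable_const) R (.of_forall fun ω => by
      rw [Real.norm_of_nonneg (le_min (norm_nonneg _) hR0.le)]; exact min_le_right _ _)
  calc ‖∫ ω, Δ n ω ∂μ‖ ≤ ∫ ω, (min ‖Δ n ω‖ R + R⁻¹ * ‖Δ n ω‖ ^ 2) ∂μ := by
        refine norm_integral_le_of_norm_le (hmin.add ((hInt n).const_mul _)) (.of_forall fun ω => ?_)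
        rcases le_total ‖Δ n ω‖ R with h | h
        · rw [min_eq_left h]
          have : 0 ≤ R⁻¹ * ‖Δ n ω‖ ^ 2 := by positivity
          linarith
        · have : ‖Δ n ω‖ ≤ R⁻¹ * ‖Δ n ω‖ ^ 2 := by
            rw [le_inv_mul_iff₀ hR0, sq]
            exact mul_le_mul_of_nonneg_right h (norm_nonneg _)
          linarith [le_min (norm_nonneg (Δ n ω)) hR0.le]
    _ = ∫ ω, min ‖Δ n ω‖ R ∂μ + R⁻¹ * ∫ ω, ‖Δ n ω‖ ^ 2 ∂μ := by
        rw [integral_add hmin ((hInt n).const_mul _), integral_const_mul]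
    _ ≤ ∫ ω, min ‖Δ n ω‖ R ∂μ + R⁻¹ * (|B| + 1) := by
        gcongr
        linarith [hB n, le_abs_self B]
    _ = ∫ ω, min ‖Δ n ω‖ R ∂μ + ε / 2 := by rw [hR]; field_simp
    _ < ε := by linarith

variable {ℱ : Filtration ℕ mΩ} {x : ℕ → Ω → ℝ}

lemma measurableSet_sum_sq_le (hx : ∀ k, StronglyMeasurable[ℱ (k + 1)] (x k)) (C a : ℝ) (k : ℕ) :
    MeasurableSet[ℱ k] {ω | ∑ j ∈ Finset.range k, (a * x j ω) ^ 2 ≤ C} := by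
  have h : Measurable[ℱ k] fun ω => ∑ j ∈ Finset.range k, (a * x j ω) ^ 2 := by
    refine Finset.measurable_sum _ fun j hj => ?_
    have := ((hx j).mono (ℱ.mono (Nat.succ_le_of_lt (Finset.mem_range.1 hj)))).measurable
    exact (this.const_mul a).pow_const 2
  exact h measurableSet_Iic

lemma stronglyMeasurable_stoppedProd (hx : ∀ k, StronglyMeasurable[ℱ (k + 1)] (x k))
    (C a : ℝ) (k : ℕ) :
    StronglyMeasurable[ℱ k] fun ω => stoppedProd C (fun j => a * x j ω) k := by
  induction k with
  | zero => exact stronglyMeasurable_const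
  | succ k ih =>
    have hle : ℱ k ≤ ℱ (k + 1) := ℱ.mono (Nat.le_succ k)
    have h1 := ih.mono hle
    exact h1.add ((((hx k).const_mul a)).smul
      ((StronglyMeasurable.ite (hle _ (measurableSet_sum_sq_le hx C a k)) h1
        stronglyMeasurable_const).const_mul Complex.I))

lemma stronglyMeasurable_ite_stoppedProd (hx : ∀ k, StronglyMeasurable[ℱ (k + 1)] (x k))
    (C a : ℝ) (k : ℕ) :
    StronglyMeasurable[ℱ k] fun ω => Complex.I *
      if ∑ j ∈ Finset.range k, (a * x j ω) ^ 2 ≤ C then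
        stoppedProd C (fun j => a * x j ω) k else 0 :=
  (StronglyMeasurable.ite (measurableSet_sum_sq_le hx C a k)
    (stronglyMeasurable_stoppedProd hx C a k) stronglyMeasurable_const).const_mul Complex.I

lemma integrable_stoppedProd_and_integral_eq_one
    (hx : ∀ k, StronglyMeasurable[ℱ (k + 1)] (x k)) (hInt : ∀ k, Integrable (x k) μ)
    (hmd : ∀ k, μ[x k | ℱ k] =ᵐ[μ] 0) {C : ℝ} (hC : 0 ≤ C) (a : ℝ) (n : ℕ) :
    Integrable (fun ω => stoppedProd C (fun j => a * x j ω) n) μ ∧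
      ∫ ω, stoppedProd C (fun j => a * x j ω) n ∂μ = 1 := by
  induction n with
  | zero => simp [stoppedProd]
  | succ k ih =>
    set D : Ω → ℂ := fun ω => Complex.I *
      if ∑ j ∈ Finset.range k, (a * x j ω) ^ 2 ≤ C then
        stoppedProd C (fun j => a * x j ω) k else 0 with hD
    have hDm : StronglyMeasurable[ℱ k] D := stronglyMeasurable_ite_stoppedProd hx C a k
    have hDb : ∀ ω, ‖D ω‖ ≤ Real.exp C := fun ω =>
      norm_ite_stoppedProd_le hC (fun j => a * x j ω) k
    have hint2 : Integrable (fun ω => (a * x k ω) • D ω) μ :=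
      ((hInt k).const_mul a).smul_bdd (Real.exp C) (hDm.mono (ℱ.le k)).aestronglyMeasurable
        (.of_forall hDb)
    have hce := condExp_bilin_of_stronglyMeasurable_left
      (ContinuousLinearMap.lsmul ℝ ℝ (E := ℂ)).flip hDm (g := fun ω => a * x k ω)
      (by simpa using hint2) ((hInt k).const_mul a)
    have hzero : μ[fun ω => a * x k ω | ℱ k] =ᵐ[μ] 0 := by
      have h1 := condExp_smul (μ := μ) a (x k) (ℱ k)
      filter_upwards [h1, hmd k] with ω h1 h2
      have : (fun ω => a * x k ω) = a • x k := rfl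
      rw [this, h1, Pi.smul_apply, h2]; simp
    have hz : ∫ ω, (a * x k ω) • D ω ∂μ = 0 := by
      rw [← integral_condExp (ℱ.le k)]
      refine integral_eq_zero_of_ae ?_
      filter_upwards [hce, hzero] with ω h1 h2
      simp only [ContinuousLinearMap.flip_apply, ContinuousLinearMap.lsmul_apply] at h1
      rw [h1, h2]; simp
    refine ⟨ih.1.add hint2, ?_⟩
    have := integral_add ih.1 hint2
    rw [ih.2, hz, add_zero] at this
    exact this

/-- **Martingale central limit theorem**, at the level of characteristic functions: if the
squares of the martingale differences `x k` satisfy the law of large numbers with limit `v`, the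
characteristic function of `n^{-1/2} ∑_{k<n} x k` tends to that of the centred normal law with
variance `v`. -/
theorem tendsto_integral_exp_sum
    (hx : ∀ k, StronglyMeasurable[ℱ (k + 1)] (x k)) (hsq : ∀ k, Integrable (fun ω => x k ω ^ 2) μ)
    (hmd : ∀ k, μ[x k | ℱ k] =ᵐ[μ] 0) {v : ℝ} (hv : ∀ k, ∫ ω, x k ω ^ 2 ∂μ = v)
    (hlln : ∀ᵐ ω ∂μ, Tendsto (fun n : ℕ => (n : ℝ)⁻¹ * ∑ k ∈ Finset.range n, x k ω ^ 2)
      atTop (𝓝 v)) :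
    Tendsto (fun n : ℕ => ∫ ω, Complex.exp
        (Complex.I * (((√(n : ℝ))⁻¹ * ∑ k ∈ Finset.range n, x k ω : ℝ) : ℂ)) ∂μ)
      atTop (𝓝 ((Real.exp (-v / 2) : ℝ) : ℂ)) := by
  have hxm : ∀ k, Measurable (x k) := fun k => ((hx k).mono (ℱ.le _)).measurable
  have hv0 : 0 ≤ v := by rw [← hv 0]; exact integral_nonneg fun ω => sq_nonneg _
  have hInt : ∀ k, Integrable (x k) μ := fun k =>
    ((memLp_two_iff_integrable_sq (hxm k).aestronglyMeasurable).2 (hsq k)).integrable one_le_two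
  have hC : (0 : ℝ) ≤ v + 1 := by linarith
  set P : ℕ → Ω → ℂ := fun n ω => stoppedProd (v + 1) (fun j => (√(n : ℝ))⁻¹ * x j ω) n with hP
  set E : ℕ → Ω → ℂ := fun n ω => Complex.exp
    (Complex.I * (((√(n : ℝ))⁻¹ * ∑ k ∈ Finset.range n, x k ω : ℝ) : ℂ)) with hE
  have hPi : ∀ n, Integrable (P n) μ ∧ ∫ ω, P n ω ∂μ = 1 := fun n =>
    integrable_stoppedProd_and_integral_eq_one hx hInt hmd hC _ n
  have hEn : ∀ n ω, ‖E n ω‖ = 1 := fun n ω => by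
    rw [hE]; simp only; rw [mul_comm]; exact Complex.norm_exp_ofReal_mul_I _
  have hEm : ∀ n, Measurable (E n) := fun n => by
    refine Complex.measurable_exp.comp (measurable_const.mul (Complex.measurable_ofReal.comp ?_))
    exact (Finset.measurable_sum _ fun j _ => hxm j).const_mul _
  have hEi : ∀ n, Integrable (E n) μ := fun n =>
    Integrable.of_bound (hEm n).aestronglyMeasurable 1 (.of_forall fun ω => (hEn n ω).le)
  set c : ℂ := ((Real.exp (-v / 2) : ℝ) : ℂ) with hc
  have hc1 : ‖c‖ ≤ 1 := by
    rw [hc, Complex.norm_real, Real.norm_of_nonneg (Real.exp_pos _).le, Real.exp_le_one_iff]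
    linarith
  have hscale : ∀ (n : ℕ) ω, ∑ j ∈ Finset.range n, ((√(n : ℝ))⁻¹ * x j ω) ^ 2
      = (n : ℝ)⁻¹ * ∑ j ∈ Finset.range n, x j ω ^ 2 := fun n ω => by
    rw [Finset.mul_sum]
    refine Finset.sum_congr rfl fun j _ => ?_
    rw [mul_pow, inv_pow, Real.sq_sqrt n.cast_nonneg]
  have hbound : ∀ n ω, ‖E n ω - P n ω * c‖ ^ 2 ≤ 2 + 2 * (Real.exp (v + 1) *
      (1 + (n : ℝ)⁻¹ * ∑ j ∈ Finset.range n, x j ω ^ 2)) := fun n ω => by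
    have h1 := norm_sq_stoppedProd_le hC (fun j => (√(n : ℝ))⁻¹ * x j ω) n
    rw [hscale] at h1
    have h2 : ‖E n ω - P n ω * c‖ ≤ 1 + ‖P n ω‖ := by
      refine (norm_sub_le _ _).trans ?_
      rw [hEn, norm_mul]
      gcongr
      exact mul_le_of_le_one_right (norm_nonneg _) hc1
    have h3 : ‖P n ω‖ ^ 2 ≤ Real.exp (v + 1) *
      (1 + (n : ℝ)⁻¹ * ∑ j ∈ Finset.range n, x j ω ^ 2) := h1
    have h4 : ‖E n ω - P n ω * c‖ ^ 2 ≤ (1 + ‖P n ω‖) ^ 2 := by gcongr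
    nlinarith [sq_nonneg (1 - ‖P n ω‖)]
  have hVi : ∀ n : ℕ, Integrable (fun ω => 2 + 2 * (Real.exp (v + 1) *
      (1 + (n : ℝ)⁻¹ * ∑ j ∈ Finset.range n, x j ω ^ 2))) μ := fun n =>
    (integrable_const _).add (((((integrable_const _).add
      ((integrable_finsetSum _ fun j _ => hsq j).const_mul _)).const_mul _)).const_mul _)
  have hΔm : ∀ n, AEStronglyMeasurable (fun ω => E n ω - P n ω * c) μ := fun n =>
    ((hEi n).sub ((hPi n).1.mul_const c)).aestronglyMeasurable
  have hΔi : ∀ n, Integrable (fun ω => ‖E n ω - P n ω * c‖ ^ 2) μ := fun n =>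
    (hVi n).mono' ((hΔm n).norm.pow 2) (.of_forall fun ω => by
      rw [Real.norm_of_nonneg (by positivity)]; exact hbound n ω)
  have hlim0 := tendsto_integral_zero_of_sq_bounded (μ := μ)
    (Δ := fun n ω => E n ω - P n ω * c) (B := 2 + 2 * (Real.exp (v + 1) * (1 + v))) hΔm hΔi
    (fun n => ?_) ?_
  · have h1 : ∀ n, ∫ ω, (E n ω - P n ω * c) ∂μ = ∫ ω, E n ω ∂μ - c := fun n => by
      rw [integral_sub (hEi n) ((hPi n).1.mul_const c), integral_mul_const, (hPi n).2, one_mul]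
    simp only [h1] at hlim0
    have h2 := hlim0.add_const c
    simp only [sub_add_cancel, zero_add] at h2
    exact h2
  · refine (integral_mono (hΔi n) (hVi n) (hbound n)).trans ?_
    have hs : Integrable (fun ω => (n : ℝ)⁻¹ * ∑ j ∈ Finset.range n, x j ω ^ 2) μ :=
      (integrable_finsetSum _ fun j _ => hsq j).const_mul _
    have hs' : Integrable (fun ω => 1 + (n : ℝ)⁻¹ * ∑ j ∈ Finset.range n, x j ω ^ 2) μ :=
      (integrable_const _).add hs
    rw [integral_add (integrable_const _) ((hs'.const_mul _).const_mul _), integral_const_mul,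
      integral_const_mul, integral_add (integrable_const _) hs,
      integral_const_mul, integral_finsetSum _ fun j _ => hsq j, integral_const, integral_const]
    simp only [hv, Finset.sum_const, Finset.card_range, nsmul_eq_mul, probReal_univ, one_smul]
    gcongr
    rcases Nat.eq_zero_or_pos n with rfl | hn
    · simpa using hv0
    · have : (n : ℝ) ≠ 0 := by positivity
      rw [inv_mul_cancel_left₀ this]
  · filter_upwards [hlln] with ω hω
    have hs : Tendsto (fun n : ℕ => ∑ j ∈ Finset.range n, ((√(n : ℝ))⁻¹ * x j ω) ^ 2) atTop
        (𝓝 v) := hω.congr fun n => (hscale n ω).symm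
    have hmax : ∀ ε > 0, ∀ᶠ n : ℕ in atTop, ∀ j < n, |(√(n : ℝ))⁻¹ * x j ω| ≤ ε := by
      intro ε hε
      filter_upwards [eventually_forall_lt_le_of_tendsto_average hω (ε ^ 2) (by positivity),
        eventually_gt_atTop 0] with n hn hn0 j hj
      have hn' : (0 : ℝ) < n := by exact_mod_cast hn0
      refine abs_le_of_sq_le_sq ?_ hε.le
      rw [mul_pow, inv_pow, Real.sq_sqrt hn'.le, inv_mul_le_iff₀ hn']
      linarith [hn j hj]
    refine (tendsto_prod_one_add_I_mul hs hmax).congr' ?_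
    filter_upwards [hs.eventually_lt_const (show v < v + 1 by linarith)] with n hn
    simp only [hP, hE, hc]
    rw [stoppedProd_eq_prod hn.le, Finset.mul_sum]

end MartingaleCLT

/-! ### Processes that are measurable functions of a driving process -/

namespace MWLSE

section Factor

variable {Ω X E : Type*} [MeasurableSpace Ω] [MeasurableSpace X] [MeasurableSpace E]
  {μ : Measure Ω} {U : ℤ → Ω → X}

/-- `Z` is, up to null sets, a fixed measurable function of the process `U`. -/
def IsFactor (μ : Measure Ω) (U : ℤ → Ω → X) (Z : ℤ → Ω → E) : Prop :=
  ∃ q : X → E, Measurable q ∧ ∀ t, Z t =ᵐ[μ] fun ω => q (U t ω)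

namespace IsFactor

lemma const (c : E) : IsFactor μ U fun _ _ => c :=
  ⟨fun _ => c, measurable_const, fun _ => .rfl⟩

lemma comp {F : Type*} [MeasurableSpace F] {Z : ℤ → Ω → E} (hZ : IsFactor μ U Z) {g : E → F}
    (hg : Measurable g) : IsFactor μ U fun t ω => g (Z t ω) := by
  obtain ⟨q, hq, h⟩ := hZ
  exact ⟨g ∘ q, hg.comp hq, fun t => (h t).mono fun ω hω => congrArg g hω⟩

lemma congr {Z Z' : ℤ → Ω → E} (hZ : IsFactor μ U Z) (h : ∀ t, Z' t =ᵐ[μ] Z t) :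
    IsFactor μ U Z' := by
  obtain ⟨q, hq, h'⟩ := hZ
  exact ⟨q, hq, fun t => (h t).trans (h' t)⟩

lemma pi {ι : Type*} [Countable ι] {Z : ι → ℤ → Ω → E} (hZ : ∀ i, IsFactor μ U (Z i)) :
    IsFactor μ U fun t ω i => Z i t ω := by
  choose q hq h using hZ
  refine ⟨fun x i => q i x, measurable_pi_lambda _ hq, fun t => ?_⟩
  filter_upwards [ae_all_iff.2 fun i => h i t] with ω hω
  exact funext hω

lemma prodMk {F : Type*} [MeasurableSpace F] {Z : ℤ → Ω → E} {Z' : ℤ → Ω → F}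
    (hZ : IsFactor μ U Z) (hZ' : IsFactor μ U Z') : IsFactor μ U fun t ω => (Z t ω, Z' t ω) := by
  obtain ⟨q, hq, h⟩ := hZ
  obtain ⟨q', hq', h'⟩ := hZ'
  refine ⟨fun x => (q x, q' x), hq.prodMk hq', fun t => ?_⟩
  filter_upwards [h t, h' t] with ω h1 h2
  rw [h1, h2]

lemma aemeasurable {Z : ℤ → Ω → E} (hZ : IsFactor μ U Z) {t : ℤ} (hU : Measurable (U t)) :
    AEMeasurable (Z t) μ := by
  obtain ⟨q, hq, h⟩ := hZ
  exact ⟨_, hq.comp hU, h t⟩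

lemma of_tendsto [TopologicalSpace E] [BorelSpace E] [PolishSpace E] [Nonempty E]
    {Z : ℕ → ℤ → Ω → E} {Z' : ℤ → Ω → E} (hZ : ∀ n, IsFactor μ U (Z n))
    (hlim : ∀ t, ∀ᵐ ω ∂μ, Tendsto (fun n => Z n t ω) atTop (𝓝 (Z' t ω))) : IsFactor μ U Z' := by
  choose q hq h using hZ
  refine ⟨fun x => limUnder atTop fun n => q n x,
    (StronglyMeasurable.limUnder fun n => (hq n).stronglyMeasurable).measurable, fun t => ?_⟩
  filter_upwards [hlim t, ae_all_iff.2 fun n => h n t] with ω h1 h2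
  simp only [h2] at h1
  exact h1.limUnder_eq.symm

lemma fderiv_apply {V : Type*} [NormedAddCommGroup V] [NormedSpace ℝ V]
    {E : Type*} [NormedAddCommGroup E] [NormedSpace ℝ E] [CompleteSpace E]
    [SecondCountableTopology E] [MeasurableSpace E] [BorelSpace E] {F : ℤ → Ω → V → E} {S : Set V}
    (hF : ∀ θ ∈ S, IsFactor μ U fun t ω => F t ω θ) {θ : V} (hθ : θ ∈ interior S)
    (hd : ∀ t, ∀ᵐ ω ∂μ, DifferentiableAt ℝ (F t ω) θ) (v : V) :
    IsFactor μ U fun t ω => fderiv ℝ (F t ω) θ v := by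
  classical
  refine of_tendsto (Z := fun (n : ℕ) t ω => if θ + (n : ℝ)⁻¹ • v ∈ S then
    (n : ℝ) • (F t ω (θ + (n : ℝ)⁻¹ • v) - F t ω θ) else 0) (fun n => ?_) fun t => ?_
  · by_cases h : θ + (n : ℝ)⁻¹ • v ∈ S
    · simp only [if_pos h]
      exact ((hF _ h).prodMk (hF θ (interior_subset hθ))).comp
        (g := fun p : E × E => (n : ℝ) • (p.1 - p.2)) (by fun_prop)
    · simpa only [if_neg h] using const 0
  · filter_upwards [hd t] with ω hω
    refine (hω.hasFDerivAt.lim v (c := fun n : ℕ => (n : ℝ)) (l := atTop) ?_).congr' ?_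
    · simpa using tendsto_natCast_atTop_atTop (R := ℝ)
    · have hlim : Tendsto (fun n : ℕ => θ + (n : ℝ)⁻¹ • v) atTop (𝓝 θ) := by
        simpa using ((tendsto_inv_atTop_nhds_zero_nat (𝕜 := ℝ)).smul_const v).const_add θ
      filter_upwards [hlim.eventually_mem (mem_interior_iff_mem_nhds.1 hθ)] with n hn
      rw [if_pos hn]

end IsFactor

end Factor

variable {Ω : Type*} {d m : ℕ} {Y : ℤ → Ω → Vec d}

/-- The sequence `(Y_t, Y_{t-1}, …)`. -/
def history (Y : ℤ → Ω → Vec d) (t : ℤ) : Ω → ℕ → Vec d := past Y (t + 1)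

lemma shift_iterate_apply (n : ℕ) (x : ℤ → Vec d) (t : ℤ) :
    (shift^[n] x) t = x (t + n) := by
  induction n generalizing x with
  | zero => simp
  | succ n ih =>
    rw [Function.iterate_succ_apply, ih]
    simp only [shift]
    congr 1
    push_cast
    ring

lemma history_eq_shift_iterate (n : ℕ) (ω : Ω) :
    history Y (n + 1) ω = fun k : ℕ => (shift^[n] fun t => Y t ω) (1 - (k : ℤ)) := by
  ext1 k
  rw [shift_iterate_apply]
  simp only [history, past]
  congr 1
  ring

variable [MeasurableSpace Ω] {μ : Measure Ω}

lemma measurable_past (hY : ∀ t, Measurable (Y t)) (t : ℤ) : Measurable (past Y t) :=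
  measurable_pi_lambda _ fun _ => hY _

lemma measurable_history (hY : ∀ t, Measurable (Y t)) (t : ℤ) : Measurable (history Y t) :=
  measurable_past hY _

lemma isFactor_history_of_past {E : Type*} [MeasurableSpace E] {Z : ℤ → Ω → E}
    (h : IsFactor μ (past Y) Z) : IsFactor μ (history Y) Z := by
  obtain ⟨q, hq, h⟩ := h
  refine ⟨fun x => q fun k => x (k + 1),
    hq.comp (measurable_pi_lambda _ fun k => measurable_pi_apply _), fun t => ?_⟩
  filter_upwards [h t] with ω hω
  rw [hω]
  congr 1
  ext1 k
  simp only [history, past]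
  congr 1
  push_cast
  ring

lemma isFactor_self : IsFactor μ (history Y) Y := by
  refine ⟨fun x => x 0, measurable_pi_apply _, fun t => .of_forall fun ω => ?_⟩
  simp [history, past]

lemma measurable_path (hY : ∀ t, Measurable (Y t)) : Measurable fun ω t => Y t ω :=
  measurable_pi_lambda _ hY

lemma sum_Icc_one_eq_sum_range {M : Type*} [AddCommMonoid M] (f : ℕ → M) (T : ℕ) :
    ∑ t ∈ Finset.Icc 1 T, f t = ∑ k ∈ Finset.range T, f (k + 1) := by
  induction T with
  | zero => simp
  | succ T ih => rw [Finset.sum_Icc_succ_top (by omega), Finset.sum_range_succ, ih]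

/-- Strong law of large numbers for factors of a stationary ergodic process. -/
lemma IsFactor.ae_tendsto_average [IsProbabilityMeasure μ] (hY : ∀ t, Measurable (Y t))
    (hE : StationaryErgodic μ Y) {Z : ℤ → Ω → ℝ} (hZ : IsFactor μ (history Y) Z)
    (hInt : Integrable (Z 1) μ) :
    ∀ᵐ ω ∂μ, Tendsto (fun T : ℕ => (T : ℝ)⁻¹ * ∑ t ∈ Finset.Icc 1 T, Z t ω) atTop
      (𝓝 (∫ ω, Z 1 ω ∂μ)) := by
  obtain ⟨q, hq, h⟩ := hZ
  set f : (ℤ → Vec d) → ℝ := fun x => q fun k : ℕ => x (1 - (k : ℤ)) with hf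
  have hfm : Measurable f :=
    hq.comp (measurable_pi_lambda _ fun k => measurable_pi_apply _)
  have hZf : ∀ n : ℕ, Z (n + 1) =ᵐ[μ] fun ω => f (shift^[n] fun t => Y t ω) := fun n => by
    filter_upwards [h (n + 1)] with ω hω
    rw [hω, history_eq_shift_iterate]
  have hZ1 : Z 1 =ᵐ[μ] f ∘ fun ω t => Y t ω := by simpa using! hZf 0
  have hp := measurable_path hY
  have : IsProbabilityMeasure (μ.map fun ω t => Y t ω) :=
    Measure.isProbabilityMeasure_map hp.aemeasurable
  have hfi : Integrable f (μ.map fun ω t => Y t ω) :=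
    (integrable_map_measure hfm.aestronglyMeasurable hp.aemeasurable).2 (hInt.congr hZ1)
  have hmean : ∫ x, f x ∂(μ.map fun ω t => Y t ω) = ∫ ω, Z 1 ω ∂μ := by
    rw [integral_map hp.aemeasurable hfm.aestronglyMeasurable]
    exact (integral_congr_ae hZ1).symm
  have hB := ae_of_ae_map hp.aemeasurable
    (ErgodicTheory.ae_tendsto_birkhoffAverage (show Ergodic shift _ from hE) hfm hfi)
  rw [hmean] at hB
  filter_upwards [hB, ae_all_iff.2 hZf] with ω h1 h2
  refine h1.congr fun T => ?_
  congr 1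
  rw [sum_Icc_one_eq_sum_range (fun t => Z t ω)]
  refine Finset.sum_congr rfl fun k _ => ?_
  rw [← h2 k]
  push_cast
  rfl

lemma map_history_eq [IsProbabilityMeasure μ] (hY : ∀ t, Measurable (Y t))
    (hE : StationaryErgodic μ Y) (n : ℕ) :
    μ.map (history Y (n + 1)) = μ.map (history Y 1) := by
  set g : (ℤ → Vec d) → ℕ → Vec d := fun x k => x (1 - (k : ℤ)) with hg
  have hgm : Measurable g := measurable_pi_lambda _ fun k => measurable_pi_apply _
  have hp := measurable_path hY
  have hs : MeasurePreserving (shift^[n]) (μ.map fun ω t => Y t ω) (μ.map fun ω t => Y t ω) :=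
    MeasurePreserving.iterate (show Ergodic shift _ from hE).toMeasurePreserving n
  have h1 : history Y (n + 1) = g ∘ shift^[n] ∘ fun ω t => Y t ω := by
    ext1 ω; rw [history_eq_shift_iterate]; rfl
  have h2 : history Y 1 = g ∘ fun ω t => Y t ω := by
    ext1 ω; simpa using! history_eq_shift_iterate (Y := Y) 0 ω
  rw [h1, h2, ← Measure.map_map hgm (hs.measurable.comp hp), ← Measure.map_map hs.measurable hp,
    hs.map_eq, Measure.map_map hgm hp]

/-- Factors of a stationary process are identically distributed. -/
lemma IsFactor.identDistrib [IsProbabilityMeasure μ] (hY : ∀ t, Measurable (Y t))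
    (hE : StationaryErgodic μ Y) {E : Type*} [MeasurableSpace E] {Z : ℤ → Ω → E}
    (hZ : IsFactor μ (history Y) Z) (n : ℕ) : IdentDistrib (Z (n + 1)) (Z 1) μ μ := by
  have h := hZ
  obtain ⟨q, hq, h'⟩ := hZ
  refine ⟨h.aemeasurable (measurable_history hY _), h.aemeasurable (measurable_history hY _), ?_⟩
  rw [Measure.map_congr (h' _), Measure.map_congr (h' 1)]
  have e : ∀ t, μ.map (fun ω => q (history Y t ω)) = (μ.map (history Y t)).map q := fun t =>
    (Measure.map_map hq (measurable_history hY t)).symm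
  rw [e, e, map_history_eq hY hE]

/-- Local uniform law of large numbers. -/
lemma exists_pos_ae_eventually_average_close [IsProbabilityMeasure μ] (hY : ∀ t, Measurable (Y t))
    (hE : StationaryErgodic μ Y) {F : ℤ → Ω → Vec m → ℝ} {S : Set (Vec m)}
    (hF : ∀ θ ∈ S, IsFactor μ (history Y) fun t ω => F t ω θ)
    (hc : ∀ t, ∀ᵐ ω ∂μ, ContinuousOn (F t ω) S)
    (hdom : ∀ t, ∫⁻ ω, ⨆ θ ∈ S, ‖F t ω θ‖ₑ ∂μ < ⊤) {θ' : Vec m} (hθ' : θ' ∈ S) {ε : ℝ}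
    (hε : 0 < ε) :
    ∃ r > 0, ∀ᵐ ω ∂μ, ∀ᶠ T : ℕ in atTop, ∀ θ ∈ S, dist θ θ' < r →
      |(T : ℝ)⁻¹ * ∑ t ∈ Finset.Icc 1 T, F t ω θ - ∫ ω, F 1 ω θ' ∂μ| ≤ ε := by
  classical
  have : Nonempty S := ⟨⟨θ', hθ'⟩⟩
  set D : ℕ → S := TopologicalSpace.denseSeq S with hD
  have hDd : DenseRange D := TopologicalSpace.denseRange_denseSeq S
  set ρ : ℕ → ℝ := fun n => 1 / ((n : ℝ) + 1) with hρ
  set O : ℕ → ℤ → Ω → ENNReal := fun n t ω =>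
    ⨆ k, if dist (D k : Vec m) θ' < ρ n then ‖F t ω (D k) - F t ω θ'‖ₑ else 0 with hO
  have hOf : ∀ n, IsFactor μ (history Y) (O n) := fun n => by
    refine (IsFactor.pi (Z := fun k t ω => if dist (D k : Vec m) θ' < ρ n then
      ‖F t ω (D k) - F t ω θ'‖ₑ else 0) fun k => ?_).comp (g := fun a : ℕ → ENNReal => ⨆ k, a k)
      (Measurable.iSup fun k => measurable_pi_apply k)
    split_ifs
    · exact ((hF _ (D k).2).prodMk (hF _ hθ')).comp (g := fun p : ℝ × ℝ => ‖p.1 - p.2‖ₑ)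
        (by fun_prop)
    · exact IsFactor.const 0
  have hOm : ∀ n t, AEMeasurable (O n t) μ := fun n t =>
    (hOf n).aemeasurable (measurable_history hY t)
  have hOle : ∀ n t ω, O n t ω ≤ 2 * ⨆ θ ∈ S, ‖F t ω θ‖ₑ := fun n t ω => by
    refine iSup_le fun k => ?_
    split_ifs
    · refine enorm_sub_le.trans ?_
      rw [two_mul]
      exact add_le_add (le_iSup₂_of_le _ (D k).2 le_rfl) (le_iSup₂_of_le _ hθ' le_rfl)
    · exact zero_le
  have hdom2 : ∀ t, ∫⁻ ω, 2 * ⨆ θ ∈ S, ‖F t ω θ‖ₑ ∂μ ≠ ⊤ := fun t => by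
    rw [lintegral_const_mul' _ _ (by simp)]
    exact ENNReal.mul_ne_top (by simp) (hdom t).ne
  have hOfin : ∀ n t, ∫⁻ ω, O n t ω ∂μ ≠ ⊤ := fun n t =>
    ne_top_of_le_ne_top (hdom2 t) (lintegral_mono (hOle n t))
  have hOlt : ∀ n t, ∀ᵐ ω ∂μ, O n t ω < ⊤ := fun n t => ae_lt_top' (hOm n t) (hOfin n t)
  have hlim : Tendsto (fun n => ∫⁻ ω, O n 1 ω ∂μ) atTop (𝓝 0) := by
    rw [← lintegral_zero (μ := μ)]
    refine tendsto_lintegral_of_dominated_convergence' _ (fun n => hOm n 1)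
      (fun n => .of_forall (hOle n 1)) (hdom2 1) ?_
    filter_upwards [hc 1] with ω hω
    rw [ENNReal.tendsto_nhds_zero]
    intro η hη
    have h1 : ∀ᶠ θ in 𝓝[S] θ', ‖F 1 ω θ - F 1 ω θ'‖ₑ ≤ η := by
      have : Tendsto (fun θ => F 1 ω θ - F 1 ω θ') (𝓝[S] θ') (𝓝 0) := by
        simpa using (hω θ' hθ').sub_const (F 1 ω θ')
      have h2 := this.enorm
      rw [enorm_zero] at h2
      exact (ENNReal.tendsto_nhds_zero.1 h2) η hη
    obtain ⟨δ, hδ, hball⟩ := Metric.mem_nhdsWithin_iff.1 h1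
    have hρ0 : Tendsto ρ atTop (𝓝 0) := tendsto_one_div_add_atTop_nhds_zero_nat
    filter_upwards [hρ0.eventually_lt_const hδ] with n hn
    refine iSup_le fun k => ?_
    split_ifs with h
    · exact hball ⟨Metric.mem_ball.2 (h.trans hn), (D k).2⟩
    · exact zero_le
  obtain ⟨n, hn⟩ := ((tendsto_order.1 hlim).2 (ENNReal.ofReal (ε / 2))
    (by simpa using hε)).exists
  have hρn : 0 < ρ n := Nat.one_div_pos_of_nat
  refine ⟨ρ n, hρn, ?_⟩
  have hfacR : IsFactor μ (history Y) fun t ω => (O n t ω).toReal :=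
    (hOf n).comp ENNReal.measurable_toReal
  have hint1 : Integrable (fun ω => F 1 ω θ') μ := by
    refine ⟨((hF θ' hθ').aemeasurable (measurable_history hY 1)).aestronglyMeasurable,
      (lintegral_mono fun ω => ?_).trans_lt (hdom 1)⟩
    exact le_iSup₂_of_le (f := fun θ (_ : θ ∈ S) => ‖F 1 ω θ‖ₑ) θ' hθ' le_rfl
  have hmeanO : ∫ ω, (O n 1 ω).toReal ∂μ < ε / 2 := by
    rw [integral_toReal (hOm n 1) (hOlt n 1)]
    have := (ENNReal.toReal_lt_toReal (hOfin n 1) (by simp)).2 hn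
    rwa [ENNReal.toReal_ofReal (by linarith)] at this
  filter_upwards [hfacR.ae_tendsto_average hY hE
      (integrable_toReal_of_lintegral_ne_top (hOm n 1) (hOfin n 1)),
    (hF θ' hθ').ae_tendsto_average hY hE hint1, ae_all_iff.2 hc,
    ae_all_iff.2 fun t => hOlt n t] with ω h1 h2 h3 h4
  have hle : ∀ t, ∀ θ ∈ S, dist θ θ' < ρ n → |F t ω θ - F t ω θ'| ≤ (O n t ω).toReal := by
    intro t θ hθ hdist
    by_contra! hlt
    have hcs : Continuous fun s : S => |F t ω s - F t ω θ'| :=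
      ((continuousOn_iff_continuous_domRestrict.1 (h3 t)).sub continuous_const).abs
    obtain ⟨k, hk1, hk2⟩ := hDd.exists_mem_open
      (s := {s : S | dist (s : Vec m) θ' < ρ n} ∩ {s : S | (O n t ω).toReal < |F t ω s - F t ω θ'|})
      ((isOpen_lt (by fun_prop) continuous_const).inter (isOpen_lt continuous_const hcs))
      ⟨⟨θ, hθ⟩, hdist, hlt⟩
    have hk3 : ‖F t ω (D k) - F t ω θ'‖ₑ ≤ O n t ω := by
      refine le_iSup_of_le k ?_
      rw [if_pos (show dist (D k : Vec m) θ' < ρ n from hk1)]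
    have := ENNReal.toReal_mono (h4 t).ne hk3
    rw [toReal_enorm, Real.norm_eq_abs] at this
    exact absurd hk2 (not_lt.2 this)
  have h2' := h2.sub_const (∫ ω, F 1 ω θ' ∂μ)
  rw [sub_self] at h2'
  filter_upwards [h1.eventually_lt_const hmeanO,
    (h2'.abs).eventually_lt_const (show |(0 : ℝ)| < ε / 2 by simpa using hε)] with T hT1 hT2 θ hθ hd
  have hT3 : |(T : ℝ)⁻¹ * ∑ t ∈ Finset.Icc 1 T, F t ω θ
      - (T : ℝ)⁻¹ * ∑ t ∈ Finset.Icc 1 T, F t ω θ'|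
      ≤ (T : ℝ)⁻¹ * ∑ t ∈ Finset.Icc 1 T, (O n t ω).toReal := by
    rw [← mul_sub, ← Finset.sum_sub_distrib, abs_mul, abs_of_nonneg (by positivity)]
    gcongr
    exact (Finset.abs_sum_le_sum_abs _ _).trans (Finset.sum_le_sum fun t _ => hle t θ hθ hd)
  have := abs_sub_le ((T : ℝ)⁻¹ * ∑ t ∈ Finset.Icc 1 T, F t ω θ)
    ((T : ℝ)⁻¹ * ∑ t ∈ Finset.Icc 1 T, F t ω θ') (∫ ω, F 1 ω θ' ∂μ)
  linarith

end MWLSE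

namespace MWLSE

/-! ### Strong consistency of minimizers of sample averages -/

section Consistency

variable {Ω : Type*} [MeasurableSpace Ω] {μ : Measure Ω} {d m : ℕ} {Y : ℤ → Ω → Vec d}

/-- Minimizers of sample averages of factors of a stationary ergodic process are strongly
consistent if the mean function has a unique minimizer. -/
theorem ae_tendsto_of_average_le [IsProbabilityMeasure μ] (hY : ∀ t, Measurable (Y t))
    (hE : StationaryErgodic μ Y) {F : ℤ → Ω → Vec m → ℝ} {Θ : Set (Vec m)} (hΘ : IsCompact Θ)
    (hF : ∀ θ ∈ Θ, IsFactor μ (history Y) fun t ω => F t ω θ)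
    (hc : ∀ t, ∀ᵐ ω ∂μ, ContinuousOn (F t ω) Θ)
    (hdom : ∀ t, ∫⁻ ω, ⨆ θ ∈ Θ, ‖F t ω θ‖ₑ ∂μ < ⊤) {θ₀ : Vec m} (hθ₀ : θ₀ ∈ Θ)
    (hid : ∀ θ ∈ Θ, θ ≠ θ₀ → ∫ ω, F 1 ω θ₀ ∂μ < ∫ ω, F 1 ω θ ∂μ)
    {θhat : ℕ → Ω → Vec m} (hmem : ∀ T, 1 ≤ T → ∀ᵐ ω ∂μ, θhat T ω ∈ Θ)
    (hmin : ∀ T : ℕ, 1 ≤ T → ∀ᵐ ω ∂μ, (T : ℝ)⁻¹ * ∑ t ∈ Finset.Icc 1 T, F t ω (θhat T ω)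
      ≤ (T : ℝ)⁻¹ * ∑ t ∈ Finset.Icc 1 T, F t ω θ₀) :
    ∀ᵐ ω ∂μ, Tendsto (fun T => θhat T ω) atTop (𝓝 θ₀) := by
  have hmem' : ∀ᵐ ω ∂μ, ∀ T, 1 ≤ T → θhat T ω ∈ Θ := by
    simpa only [ae_all_iff] using hmem
  have hmin' : ∀ᵐ ω ∂μ, ∀ T : ℕ, 1 ≤ T → (T : ℝ)⁻¹ * ∑ t ∈ Finset.Icc 1 T, F t ω (θhat T ω)
      ≤ (T : ℝ)⁻¹ * ∑ t ∈ Finset.Icc 1 T, F t ω θ₀ := by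
    simpa only [ae_all_iff] using hmin
  have key : ∀ n : ℕ, ∀ᵐ ω ∂μ, ∀ᶠ T in atTop, dist (θhat T ω) θ₀ < 1 / ((n : ℝ) + 1) := by
    intro n
    set δ : ℝ := 1 / ((n : ℝ) + 1)
    set K : Set (Vec m) := Θ \ Metric.ball θ₀ δ with hK
    have hKc : IsCompact K := hΘ.diff Metric.isOpen_ball
    have hKne : ∀ θ ∈ K, θ ≠ θ₀ := fun θ hθ h => hθ.2 (by
      rw [h]; exact Metric.mem_ball_self Nat.one_div_pos_of_nat)
    set η : Vec m → ℝ := fun θ => (∫ ω, F 1 ω θ ∂μ - ∫ ω, F 1 ω θ₀ ∂μ) / 3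
    have hη : ∀ θ ∈ K, 0 < η θ := fun θ hθ => by
      have := hid θ hθ.1 (hKne θ hθ)
      simp only [η]; linarith
    have hloc : ∀ θ' : K, ∃ r > 0, ∀ᵐ ω ∂μ, ∀ᶠ T : ℕ in atTop, ∀ θ ∈ Θ, dist θ θ' < r →
        |(T : ℝ)⁻¹ * ∑ t ∈ Finset.Icc 1 T, F t ω θ - ∫ ω, F 1 ω θ' ∂μ| ≤ η θ' := fun θ' =>
      exists_pos_ae_eventually_average_close hY hE hF hc hdom θ'.2.1 (hη _ θ'.2)
    choose r hr hav using hloc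
    obtain ⟨I, hI⟩ := hKc.elim_finite_subcover (fun θ' : K => Metric.ball (θ' : Vec m) (r θ'))
      (fun θ' => Metric.isOpen_ball) fun θ hθ =>
        Set.mem_iUnion.2 ⟨⟨θ, hθ⟩, Metric.mem_ball_self (hr _)⟩
    have hint0 : Integrable (fun ω => F 1 ω θ₀) μ := by
      refine ⟨((hF θ₀ hθ₀).aemeasurable (measurable_history hY 1)).aestronglyMeasurable,
        (lintegral_mono fun ω => ?_).trans_lt (hdom 1)⟩
      exact le_iSup₂_of_le (f := fun θ (_ : θ ∈ Θ) => ‖F 1 ω θ‖ₑ) θ₀ hθ₀ le_rfl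
    filter_upwards [hmem', hmin', ae_all_iff.2 fun i : I => hav i,
      (hF θ₀ hθ₀).ae_tendsto_average hY hE hint0] with ω h1 h2 h3 h4
    have h5 : ∀ᶠ T : ℕ in atTop, ∀ i : I, (T : ℝ)⁻¹ * ∑ t ∈ Finset.Icc 1 T, F t ω θ₀
        < ∫ ω, F 1 ω θ₀ ∂μ + η (i : K) := eventually_all.2 fun i =>
      h4.eventually_lt_const (by linarith [hη _ (i : K).2])
    filter_upwards [eventually_all.2 h3, h5, eventually_ge_atTop 1] with T g1 g2 g3
    by_contra hnot
    have hKmem : θhat T ω ∈ K := ⟨h1 T g3, fun h => hnot (Metric.mem_ball.1 h)⟩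
    obtain ⟨i, hiI, hi⟩ := Set.mem_iUnion₂.1 (hI hKmem)
    have a1 := abs_le.1 (g1 ⟨i, hiI⟩ _ (h1 T g3) (Metric.mem_ball.1 hi))
    have a2 := g2 ⟨i, hiI⟩
    have a3 := h2 T g3
    have a4 : 3 * η i = ∫ ω, F 1 ω i ∂μ - ∫ ω, F 1 ω θ₀ ∂μ := by simp only [η]; ring
    have a5 := hη _ i.2
    simp only at a1 a2
    linarith [a1.1]
  filter_upwards [ae_all_iff.2 key] with ω hω
  rw [Metric.tendsto_nhds]
  intro ε hε
  obtain ⟨n, hn⟩ := exists_nat_one_div_lt hε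
  exact (hω n).mono fun T hT => hT.trans hn

end Consistency

/-! ### The conditional mean and its residual -/

variable {Ω : Type*} {d m : ℕ} {Y : ℤ → Ω → Vec d}
  {lam : (ℕ → Vec d) → Vec m → Vec d} {W : (ℕ → Vec d) → Matrix (Fin d) (Fin d) ℝ}
  {Θ : Set (Vec m)} {θ θ₀ : Vec m}

/-- The vector `A v`. -/
noncomputable def mulVecLp {k l : ℕ} (A : Matrix (Fin k) (Fin l) ℝ) (v : Vec l) : Vec k :=
  WithLp.toLp 2 (A.mulVec v.ofLp)

lemma inner_mulVecLp {k l : ℕ} (A : Matrix (Fin k) (Fin l) ℝ) (v : Vec l) (w : Vec k) :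
    inner ℝ (mulVecLp A v) w = w.ofLp ⬝ᵥ A.mulVec v.ofLp := by
  simp [mulVecLp, EuclideanSpace.inner_eq_star_dotProduct]

lemma dotProduct_mulVec_comm {A : Matrix (Fin d) (Fin d) ℝ} (hA : A.IsHermitian)
    (u v : Fin d → ℝ) : u ⬝ᵥ A.mulVec v = v ⬝ᵥ A.mulVec u := by
  have h : A.transpose = A := by simpa [Matrix.IsHermitian] using! hA
  rw [Matrix.dotProduct_mulVec, ← Matrix.mulVec_transpose, h, dotProduct_comm]

lemma past_measurable_sigmaField (t : ℤ) :
    Measurable[sigmaField Y (t - 1)] (past Y t) := by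
  refine @measurable_pi_lambda _ _ _ (_) _ _ fun k => ?_
  have hk : t - 1 - (k : ℤ) ≤ t - 1 := by omega
  exact (comap_measurable (Y (t - 1 - k))).mono
    (le_iSup (fun s : {s : ℤ // s ≤ t - 1} => MeasurableSpace.comap (Y s) inferInstance)
      ⟨t - 1 - k, hk⟩) le_rfl

lemma continuousOn_loss {t : ℤ} {ω : Ω} (h : ContinuousOn (condMean Y lam t ω) Θ) :
    ContinuousOn (loss Y lam W t ω) Θ := by
  have hcont : Continuous fun v : Vec d =>
      (Y t ω - v).ofLp ⬝ᵥ (weight Y W t ω).mulVec (Y t ω - v).ofLp := by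
    simp only [dotProduct, Matrix.mulVec]
    fun_prop
  exact hcont.comp_continuousOn h

variable [mΩ : MeasurableSpace Ω] {μ : Measure Ω}

lemma sigmaField_le (hY : ∀ t, Measurable (Y t)) (t : ℤ) : sigmaField Y t ≤ mΩ :=
  iSup_le fun s => (hY s).comap_le

lemma IsFactor.aestronglyMeasurable_sigmaField {Z : ℤ → Ω → Vec d}
    (hZ : IsFactor μ (past Y) Z) (t : ℤ) :
    AEStronglyMeasurable[sigmaField Y (t - 1)] (Z t) μ := by
  obtain ⟨q, hq, h⟩ := hZ
  have hm : Measurable[sigmaField Y (t - 1)] fun ω => q (past Y t ω) :=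
    hq.comp (past_measurable_sigmaField t)
  exact ⟨_, hm.stronglyMeasurable, h t⟩

lemma isFactor_condMean (hlam : Measurable fun p : (ℕ → Vec d) × Θ => lam p.1 p.2)
    (hθ : θ ∈ Θ) : IsFactor μ (past Y) fun t ω => condMean Y lam t ω θ :=
  ⟨fun x => lam x θ, hlam.comp (measurable_id.prodMk (measurable_const (a := (⟨θ, hθ⟩ : Θ)))),
    fun _ => .rfl⟩

lemma isFactor_weight (hW : ∀ i j, Measurable fun x => W x i j) :
    IsFactor μ (past Y) fun t ω (p : Fin d × Fin d) => weight Y W t ω p.1 p.2 :=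
  ⟨fun x p => W x p.1 p.2, measurable_pi_lambda _ fun p => hW p.1 p.2, fun _ => .rfl⟩

lemma isFactor_loss (hW : ∀ i j, Measurable fun x => W x i j)
    (hlam : Measurable fun p : (ℕ → Vec d) × Θ => lam p.1 p.2) (hθ : θ ∈ Θ) :
    IsFactor μ (history Y) fun t ω => loss Y lam W t ω θ := by
  have h := ((isFactor_self (μ := μ) (Y := Y)).prodMk (isFactor_history_of_past
    ((isFactor_condMean hlam hθ).prodMk (isFactor_weight hW)))).comp
    (g := fun p : Vec d × (Vec d × (Fin d × Fin d → ℝ)) =>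
      ∑ i, (p.1 i - p.2.1 i) * ∑ j, p.2.2 (i, j) * (p.1 j - p.2.1 j)) (by fun_prop)
  exact h

/-- The residual is orthogonal to the past. -/
lemma condExp_inner_residual [IsProbabilityMeasure μ] (hY : ∀ t, Measurable (Y t))
    (hYint : ∀ t, Integrable (Y t) μ) {t : ℤ}
    (hmean : μ[Y t | sigmaField Y (t - 1)] =ᵐ[μ] fun ω => condMean Y lam t ω θ₀)
    {A : Ω → Vec d} (hA : AEStronglyMeasurable[sigmaField Y (t - 1)] A μ)
    (hInt : Integrable (fun ω => inner ℝ (A ω) (Y t ω - condMean Y lam t ω θ₀)) μ) :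
    μ[fun ω => inner ℝ (A ω) (Y t ω - condMean Y lam t ω θ₀) | sigmaField Y (t - 1)] =ᵐ[μ] 0 := by
  have hcm : Integrable (fun ω => condMean Y lam t ω θ₀) μ := integrable_condExp.congr hmean
  have hres : Integrable (fun ω => Y t ω - condMean Y lam t ω θ₀) μ := (hYint t).sub hcm
  have h1 := condExp_bilin_of_aestronglyMeasurable_left (innerSL ℝ) hA
    (g := fun ω => Y t ω - condMean Y lam t ω θ₀) hInt hres
  have h2 : μ[fun ω => Y t ω - condMean Y lam t ω θ₀ | sigmaField Y (t - 1)] =ᵐ[μ] 0 := by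
    have h3 := condExp_sub (hYint t) hcm (sigmaField Y (t - 1))
    have h4 : μ[fun ω => condMean Y lam t ω θ₀ | sigmaField Y (t - 1)] =ᵐ[μ]
        μ[Y t | sigmaField Y (t - 1)] := by
      refine (condExp_congr_ae hmean.symm).trans ?_
      rw [condExp_of_stronglyMeasurable (sigmaField_le hY _) stronglyMeasurable_condExp
        integrable_condExp]
    filter_upwards [h3, h4] with ω h5 h6
    refine h5.trans ?_
    rw [Pi.sub_apply, h6, sub_self]
    rfl
  refine h1.trans ?_
  filter_upwards [h2] with ω hω
  rw [hω]
  simp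

lemma integrable_loss (hY : ∀ t, Measurable (Y t)) (hW : ∀ i j, Measurable fun x => W x i j)
    (hlam : Measurable fun p : (ℕ → Vec d) × Θ => lam p.1 p.2) {t : ℤ}
    (hmom : ∫⁻ ω, ⨆ θ ∈ Θ, ‖loss Y lam W t ω θ‖ₑ ∂μ < ⊤) (hθ : θ ∈ Θ) :
    Integrable (fun ω => loss Y lam W t ω θ) μ := by
  refine ⟨((isFactor_loss hW hlam hθ).aemeasurable
    (measurable_history hY t)).aestronglyMeasurable, (lintegral_mono fun ω => ?_).trans_lt hmom⟩
  exact le_iSup₂_of_le (f := fun θ (_ : θ ∈ Θ) => ‖loss Y lam W t ω θ‖ₑ) θ hθ le_rfl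

/-- The mean loss is uniquely minimized at the true parameter. -/
lemma integral_loss_lt [IsProbabilityMeasure μ] (hY : ∀ t, Measurable (Y t))
    (hYint : ∀ t, Integrable (Y t) μ) (hW : ∀ i j, Measurable fun x => W x i j)
    (hlam : Measurable fun p : (ℕ → Vec d) × Θ => lam p.1 p.2) {t : ℤ}
    (hmean : μ[Y t | sigmaField Y (t - 1)] =ᵐ[μ] fun ω => condMean Y lam t ω θ₀)
    (hmom : ∫⁻ ω, ⨆ θ ∈ Θ, ‖loss Y lam W t ω θ‖ₑ ∂μ < ⊤)
    (hpd : ∀ᵐ ω ∂μ, (weight Y W t ω).PosDef) (hθ₀ : θ₀ ∈ Θ) (hθ : θ ∈ Θ)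
    (hne : ¬ ∀ᵐ ω ∂μ, condMean Y lam t ω θ = condMean Y lam t ω θ₀) :
    ∫ ω, loss Y lam W t ω θ₀ ∂μ < ∫ ω, loss Y lam W t ω θ ∂μ := by
  set δ : Ω → Vec d := fun ω => condMean Y lam t ω θ₀ - condMean Y lam t ω θ with hδ
  set r : Ω → Vec d := fun ω => Y t ω - condMean Y lam t ω θ₀ with hr
  set Q : Ω → ℝ := fun ω => (δ ω).ofLp ⬝ᵥ (weight Y W t ω).mulVec (δ ω).ofLp with hQ
  set C : Ω → ℝ := fun ω => inner ℝ (mulVecLp (weight Y W t ω) (δ ω)) (r ω) with hC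
  have hsplit : ∀ᵐ ω ∂μ, loss Y lam W t ω θ = loss Y lam W t ω θ₀ + 2 * C ω + Q ω := by
    filter_upwards [hpd] with ω hω
    have e : Y t ω - condMean Y lam t ω θ = r ω + δ ω := by simp [hr, hδ]
    simp only [hC, inner_mulVecLp, hQ, loss, e, WithLp.ofLp_add, Matrix.mulVec_add,
      dotProduct_add, add_dotProduct]
    rw [dotProduct_mulVec_comm hω.isHermitian (δ ω).ofLp (r ω).ofLp]
    simp only [hr]
    ring
  have hQ0 : ∀ᵐ ω ∂μ, 0 ≤ Q ω := by
    filter_upwards [hpd] with ω hω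
    simpa using hω.posSemidef.dotProduct_mulVec_nonneg (δ ω).ofLp
  have hi := integrable_loss hY hW hlam hmom hθ
  have hi0 := integrable_loss hY hW hlam hmom hθ₀
  have hQf : IsFactor μ (past Y) fun t ω =>
      (condMean Y lam t ω θ₀ - condMean Y lam t ω θ).ofLp ⬝ᵥ
        (weight Y W t ω).mulVec (condMean Y lam t ω θ₀ - condMean Y lam t ω θ).ofLp :=
    (((isFactor_condMean hlam hθ₀).prodMk (isFactor_condMean hlam hθ)).prodMk
      (isFactor_weight hW)).comp (g := fun p : (Vec d × Vec d) × (Fin d × Fin d → ℝ) =>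
        ∑ i, (p.1.1 i - p.1.2 i) * ∑ j, p.2 (i, j) * (p.1.1 j - p.1.2 j)) (by fun_prop)
  have hQi : Integrable Q μ := by
    refine ((hi.add hi0).const_mul 2).mono'
      (hQf.aemeasurable (measurable_past hY t)).aestronglyMeasurable ?_
    filter_upwards [hpd, hQ0, hsplit] with ω h1 h2 h3
    rw [Real.norm_of_nonneg h2]
    have h4 := h1.posSemidef.dotProduct_mulVec_nonneg ((r ω).ofLp + ((r ω).ofLp + (δ ω).ofLp))
    simp only [star_trivial, Matrix.mulVec_add, dotProduct_add, add_dotProduct] at h4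
    rw [dotProduct_mulVec_comm h1.isHermitian (δ ω).ofLp (r ω).ofLp] at h4
    have h5 : loss Y lam W t ω θ₀ = (r ω).ofLp ⬝ᵥ (weight Y W t ω).mulVec (r ω).ofLp := rfl
    have h6 : C ω = (r ω).ofLp ⬝ᵥ (weight Y W t ω).mulVec (δ ω).ofLp := by
      simp only [hC, inner_mulVecLp]
    have h7 : Q ω = (δ ω).ofLp ⬝ᵥ (weight Y W t ω).mulVec (δ ω).ofLp := rfl
    simp only [Pi.add_apply]
    rw [← h5, ← h6, ← h7] at h4
    linarith
  have hCi : Integrable C μ := by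
    refine (((hi.sub hi0).sub hQi).div_const 2).congr ?_
    filter_upwards [hsplit] with ω h
    simp only [Pi.sub_apply]
    rw [h]; ring
  have hAf : IsFactor μ (past Y) fun t ω =>
      mulVecLp (weight Y W t ω) (condMean Y lam t ω θ₀ - condMean Y lam t ω θ) :=
    (((isFactor_condMean hlam hθ₀).prodMk (isFactor_condMean hlam hθ)).prodMk
      (isFactor_weight hW)).comp (g := fun p : (Vec d × Vec d) × (Fin d × Fin d → ℝ) =>
        WithLp.toLp 2 fun i => ∑ j, p.2 (i, j) * (p.1.1 j - p.1.2 j)) (by fun_prop)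
  have hC0 : ∫ ω, C ω ∂μ = 0 := by
    rw [← integral_condExp (sigmaField_le hY (t - 1))]
    exact integral_eq_zero_of_ae
      (condExp_inner_residual hY hYint hmean (hAf.aestronglyMeasurable_sigmaField t) hCi)
  have hQpos : 0 < ∫ ω, Q ω ∂μ := by
    refine lt_of_le_of_ne (integral_nonneg_of_ae hQ0) fun h0 => hne ?_
    have hz := (integral_eq_zero_iff_of_nonneg_ae hQ0 hQi).1 h0.symm
    filter_upwards [hz, hpd] with ω h1 h2
    by_contra hcon
    have hδ0 : (δ ω).ofLp ≠ 0 := fun h => hcon (by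
      have : δ ω = 0 := by ext i; exact congrFun h i
      exact (sub_eq_zero.1 this).symm)
    have := h2.dotProduct_mulVec_pos hδ0
    simp only [star_trivial] at this
    exact this.ne' h1
  have htot : ∫ ω, loss Y lam W t ω θ ∂μ = ∫ ω, loss Y lam W t ω θ₀ ∂μ + ∫ ω, Q ω ∂μ := by
    have hi1 : Integrable (fun ω => loss Y lam W t ω θ₀ + 2 * C ω) μ := hi0.add (hCi.const_mul 2)
    rw [integral_congr_ae hsplit, integral_add hi1 hQi,
      integral_add hi0 (hCi.const_mul 2), integral_const_mul, hC0]
    simp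
  linarith

end MWLSE

namespace MWLSE

/-! ### Convergence in distribution up to a relative error -/

/-- If the characteristic functions of `N T` converge to that of `ν` and `Z T` differs from `N T`
by an asymptotically negligible relative error, then `Z T` converges in distribution to `ν`. -/
lemma tendstoInDistribution_of_charFun_of_relative_error {Ω : Type*} [MeasurableSpace Ω]
    {μ : Measure Ω} [IsProbabilityMeasure μ] {m : ℕ} {ν : Measure (Vec m)} [IsProbabilityMeasure ν]
    {N Z : ℕ → Ω → Vec m} (hN : ∀ T, AEMeasurable (N T) μ) (hZ : ∀ T, AEMeasurable (Z T) μ)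
    (hchar : ∀ u, Tendsto (fun T => charFun (μ.map (N T)) u) atTop (𝓝 (charFun ν u)))
    (herr : ∀ᵐ ω ∂μ, ∀ ε > 0, ∀ᶠ T in atTop, ‖N T ω - Z T ω‖ ≤ ε * ‖Z T ω‖) :
    TendstoInDistribution Z atTop id (fun _ => μ) ν := by
  have hprob : ∀ T, IsProbabilityMeasure (μ.map (N T)) := fun T =>
    Measure.isProbabilityMeasure_map (hN T)
  have hND : TendstoInDistribution N atTop id (fun _ => μ) ν := by
    refine ⟨hN, aemeasurable_id, ?_⟩
    refine ProbabilityMeasure.tendsto_iff_tendsto_charFun.2 fun u => ?_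
    simpa [Measure.map_id] using! hchar u
  have htight : IsTightMeasureSet (Set.range fun T => μ.map (N T)) :=
    isTightMeasureSet_of_tendsto_charFun (f := charFun ν) (by fun_prop) hchar
  have hVm : ∀ T, AEMeasurable (fun ω => ‖Z T ω - N T ω‖ / (1 + ‖N T ω‖)) μ := fun T =>
    ((hZ T).sub (hN T)).norm.div ((hN T).norm.const_add 1)
  have hV : ∀ᵐ ω ∂μ, Tendsto (fun T => ‖Z T ω - N T ω‖ / (1 + ‖N T ω‖)) atTop (𝓝 0) := by
    filter_upwards [herr] with ω hω
    rw [Metric.tendsto_nhds]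
    intro ε hε
    set δ : ℝ := min (1 / 2) (ε / 4) with hδ
    have hδ0 : 0 < δ := by positivity
    filter_upwards [hω δ hδ0] with T hT
    rw [Real.dist_eq, sub_zero, abs_of_nonneg (by positivity), div_lt_iff₀ (by positivity),
      norm_sub_rev]
    have h1 : δ ≤ 1 / 2 := min_le_left _ _
    have h2 : δ ≤ ε / 4 := min_le_right _ _
    have h3 : ‖Z T ω‖ ≤ ‖N T ω‖ + ‖N T ω - Z T ω‖ := by
      have := norm_sub_le (N T ω) (N T ω - Z T ω)
      rwa [sub_sub_cancel] at this
    have h4 : ‖Z T ω‖ ≤ 2 * ‖N T ω‖ := by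
      nlinarith [mul_le_mul_of_nonneg_right h1 (norm_nonneg (Z T ω))]
    have h5 := mul_le_mul_of_nonneg_right h2 (norm_nonneg (Z T ω))
    have h6 : ε / 4 * ‖Z T ω‖ ≤ ε / 4 * (2 * ‖N T ω‖) := by gcongr
    nlinarith [norm_nonneg (N T ω), mul_nonneg hε.le (norm_nonneg (N T ω))]
  have hVmeas := tendstoInMeasure_of_tendsto_ae (fun T => (hVm T).aestronglyMeasurable) hV
  refine tendstoInDistribution_of_tendstoInMeasure_sub Z id hND ?_ hZ
  rw [tendstoInMeasure_iff_norm] at hVmeas ⊢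
  intro ε hε
  rw [ENNReal.tendsto_nhds_zero]
  intro η hη
  have hη2 : 0 < η / 2 := ENNReal.half_pos hη.ne'
  obtain ⟨R, hR, hR0⟩ := (((ENNReal.tendsto_nhds_zero.1
    (tendsto_measure_norm_gt_of_isTightMeasureSet htight)) (η / 2) hη2).and
    (eventually_ge_atTop 0)).exists
  filter_upwards [(ENNReal.tendsto_nhds_zero.1 (hVmeas (ε / (1 + R)) (by positivity))) _ hη2]
    with T hT
  have hsub : {ω | ε ≤ ‖(Z - N) T ω - (0 : Ω → Vec m) ω‖} ⊆
      {ω | ε / (1 + R) ≤ ‖‖Z T ω - N T ω‖ / (1 + ‖N T ω‖) - 0‖} ∪ N T ⁻¹' {x | R < ‖x‖} := by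
    intro ω hω
    by_cases h : R < ‖N T ω‖
    · exact Or.inr h
    · refine Or.inl ?_
      have hω' : ε ≤ ‖Z T ω - N T ω‖ := by simpa using! hω
      change ε / (1 + R) ≤ ‖‖Z T ω - N T ω‖ / (1 + ‖N T ω‖) - 0‖
      rw [sub_zero, Real.norm_of_nonneg (by positivity)]
      gcongr
      exact not_lt.1 h
  have hNT : μ (N T ⁻¹' {x | R < ‖x‖}) ≤ η / 2 := by
    rw [← Measure.map_apply_of_aemeasurable (hN T)
      (measurableSet_lt measurable_const measurable_norm)]
    exact (le_iSup₂_of_le (f := fun (ρ : Measure (Vec m)) (_ : ρ ∈ Set.range fun T => μ.map (N T))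
      => ρ {x | R < ‖x‖}) _ ⟨T, rfl⟩ le_rfl).trans hR
  calc _ ≤ _ := measure_mono hsub
    _ ≤ _ := measure_union_le _ _
    _ ≤ η / 2 + η / 2 := add_le_add hT hNT
    _ = η := ENNReal.add_halves η

/-! ### Differential calculus on Euclidean space -/

variable {m : ℕ}

lemma eq_sum_smul_stdVec (v : Vec m) : v = ∑ i, v i • stdVec i := by
  ext j
  simp [stdVec, Finset.sum_apply, Pi.single_apply]

lemma norm_stdVec (i : Fin m) : ‖(stdVec i : Vec m)‖ = 1 := by simp [stdVec]

lemma abs_apply_le_norm (v : Vec m) (i : Fin m) : |v i| ≤ ‖v‖ := by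
  have := PiLp.norm_apply_le v i
  simpa using this

lemma norm_le_of_abs_apply_le {v : Vec m} {c : ℝ} (h : ∀ i, |v i| ≤ c) : ‖v‖ ≤ m * c := by
  rw [eq_sum_smul_stdVec v]
  refine (norm_sum_le_of_le (f := fun i => v i • (stdVec i : Vec m)) Finset.univ (n := fun _ => c)
    fun i _ => ?_).trans (by simp)
  rw [norm_smul, norm_stdVec, mul_one]
  exact h i

lemma clm_apply_eq_sum (L : Vec m →L[ℝ] ℝ) (v : Vec m) : L v = ∑ i, v i * L (stdVec i) := by
  conv_lhs => rw [eq_sum_smul_stdVec v]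
  simp

lemma norm_clm_le_of_abs_apply_le {L : Vec m →L[ℝ] ℝ} {c : ℝ} (hc : 0 ≤ c)
    (h : ∀ i, |L (stdVec i)| ≤ c) : ‖L‖ ≤ m * c := by
  refine L.opNorm_le_bound (by positivity) fun v => ?_
  rw [clm_apply_eq_sum]
  refine (norm_sum_le_of_le (f := fun i => v i * L (stdVec i)) Finset.univ
    (n := fun _ => ‖v‖ * c) fun i _ => ?_).trans (by simp [mul_comm, mul_assoc, mul_left_comm])
  rw [norm_mul]
  exact mul_le_mul (abs_apply_le_norm v i) (h i) (abs_nonneg _) (norm_nonneg _)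

/-- Mean value inequality with respect to a constant gradient `c`. -/
lemma abs_sub_sub_le_of_fderiv_close {f : Vec m → ℝ} {θ₀ θ : Vec m} {r η : ℝ} (hη : 0 ≤ η)
    {c : Fin m → ℝ} (hd : ∀ x ∈ Metric.ball θ₀ r, DifferentiableAt ℝ f x)
    (hc : ∀ x ∈ Metric.ball θ₀ r, ∀ i, |fderiv ℝ f x (stdVec i) - c i| ≤ η)
    (hθ : θ ∈ Metric.ball θ₀ r) :
    |f θ - f θ₀ - ∑ i, (θ - θ₀) i * c i| ≤ m * η * ‖θ - θ₀‖ := by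
  set φ : Vec m →L[ℝ] ℝ := ∑ i, c i • EuclideanSpace.proj i with hφ
  have hφi : ∀ i, φ (stdVec i) = c i := fun i => by
    simp [hφ, stdVec]
  have hr : 0 < r := Metric.pos_of_mem_ball hθ
  have h := (convex_ball θ₀ r).norm_image_sub_le_of_norm_hasFDerivWithin_le' (𝕜 := ℝ) (f := f)
    (f' := fun x => fderiv ℝ f x) (φ := φ) (C := m * η)
    (fun x hx => (hd x hx).hasFDerivAt.hasFDerivWithinAt)
    (fun x hx => norm_clm_le_of_abs_apply_le hη fun i => by
      rw [sub_apply, hφi]; exact hc x hx i)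
    (Metric.mem_ball_self hr) hθ
  rw [clm_apply_eq_sum φ] at h
  simpa only [hφi, Real.norm_eq_abs] using h

lemma enorm_apply_le_matSpectralNorm (A : Matrix (Fin m) (Fin m) ℝ) (i j : Fin m) :
    ‖A i j‖ₑ ≤ matSpectralNorm A := by
  have h1 : A i j = inner ℝ (stdVec i) (Matrix.toEuclideanCLM (n := Fin m) (𝕜 := ℝ) A (stdVec j)) := by
    rw [Matrix.inner_toEuclideanCLM]
    simp [stdVec]
  have h2 : ‖A i j‖ ≤ ‖Matrix.toEuclideanCLM (n := Fin m) (𝕜 := ℝ) A‖ := by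
    rw [h1]
    refine (norm_inner_le_norm _ _).trans ?_
    rw [norm_stdVec, one_mul]
    refine (ContinuousLinearMap.le_opNorm _ _).trans ?_
    rw [norm_stdVec, mul_one]
  rw [matSpectralNorm, ← ofReal_norm, ← ofReal_norm]
  exact ENNReal.ofReal_le_ofReal h2

/-! ### Derivatives of the loss -/

variable {Ω : Type*} {d : ℕ} {Y : ℤ → Ω → Vec d}
  {lam : (ℕ → Vec d) → Vec m → Vec d} {W : (ℕ → Vec d) → Matrix (Fin d) (Fin d) ℝ}
  {S Θ : Set (Vec m)} {θ θ₀ : Vec m} {t : ℤ} {ω : Ω}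

lemma loss_eq_inner : loss Y lam W t ω = fun θ => inner ℝ (Y t ω - condMean Y lam t ω θ)
    (Matrix.toEuclideanCLM (n := Fin d) (𝕜 := ℝ) (weight Y W t ω)
      (Y t ω - condMean Y lam t ω θ)) := by
  ext θ
  rw [Matrix.inner_toEuclideanCLM, loss]

lemma contDiffOn_loss (h : ContDiffOn ℝ 2 (condMean Y lam t ω) S) :
    ContDiffOn ℝ 2 (loss Y lam W t ω) S := by
  rw [loss_eq_inner]
  have h1 : ContDiffOn ℝ 2 (fun θ => Y t ω - condMean Y lam t ω θ) S := contDiffOn_const.sub h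
  exact h1.inner ℝ ((ContinuousLinearMap.contDiff _).comp_contDiffOn h1)

lemma contDiffOn_fderiv_loss (hS : IsOpen S) (h : ContDiffOn ℝ 2 (condMean Y lam t ω) S)
    (v : Vec m) : ContDiffOn ℝ 1 (fun θ => fderiv ℝ (loss Y lam W t ω) θ v) S :=
  ((contDiffOn_loss h).fderiv_of_isOpen hS (by norm_num)).clm_apply contDiffOn_const

lemma continuousOn_hessian_loss (hS : IsOpen S) (h : ContDiffOn ℝ 2 (condMean Y lam t ω) S)
    (i j : Fin m) : ContinuousOn (fun θ => hessian (loss Y lam W t ω) θ i j) S :=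
  (((contDiffOn_fderiv_loss hS h (stdVec j)).fderiv_of_isOpen (m := 0) hS
    (by norm_num)).clm_apply contDiffOn_const).continuousOn

/-- The gradient of the loss is `-2` times the score. -/
lemma fderiv_loss_stdVec (hW : (weight Y W t ω).IsHermitian)
    (h : DifferentiableAt ℝ (condMean Y lam t ω) θ) (j : Fin m) :
    fderiv ℝ (loss Y lam W t ω) θ (stdVec j) = -2 * score Y lam W t ω θ j := by
  set L := Matrix.toEuclideanCLM (n := Fin d) (𝕜 := ℝ) (weight Y W t ω) with hL
  have h1 : HasFDerivAt (fun θ => Y t ω - condMean Y lam t ω θ)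
      (-fderiv ℝ (condMean Y lam t ω) θ) θ := h.hasFDerivAt.const_sub _
  have h2 := h1.inner ℝ (L.hasFDerivAt.comp θ h1)
  rw [loss_eq_inner]
  refine (congrArg (fun A : Vec m →L[ℝ] ℝ => A (stdVec j)) h2.fderiv).trans ?_
  have h4 : ((fderiv ℝ (condMean Y lam t ω) θ) (stdVec j)).ofLp ⬝ᵥ
      (weight Y W t ω).mulVec (Y t ω - condMean Y lam t ω θ).ofLp
      = score Y lam W t ω θ j := by
    simp [score, Matrix.mulVec, dotProduct, jacobian, Matrix.transpose_apply]
  rw [← h4]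
  simp only [ContinuousLinearMap.comp_apply, ContinuousLinearMap.prod_apply,
    neg_apply, Function.comp_apply, fderivInnerCLM_apply, map_neg,
    inner_neg_left, inner_neg_right, hL, Matrix.inner_toEuclideanCLM]
  rw [dotProduct_mulVec_comm hW (Y t ω - condMean Y lam t ω θ).ofLp]
  ring

variable [MeasurableSpace Ω] {μ : Measure Ω}

lemma isFactor_fderiv_loss (hW : ∀ i j, Measurable fun x => W x i j)
    (hlam : Measurable fun p : (ℕ → Vec d) × Θ => lam p.1 p.2)
    (hcd : ∀ t, ∀ᵐ ω ∂μ, ContDiffOn ℝ 2 (condMean Y lam t ω) (interior Θ))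
    (hθ : θ ∈ interior Θ) (v : Vec m) :
    IsFactor μ (history Y) fun t ω => fderiv ℝ (loss Y lam W t ω) θ v := by
  refine IsFactor.fderiv_apply (S := Θ) (fun θ hθ => isFactor_loss hW hlam hθ) hθ (fun t => ?_) v
  filter_upwards [hcd t] with ω hω
  exact ((contDiffOn_loss hω).differentiableOn (by norm_num)).differentiableAt
    (isOpen_interior.mem_nhds hθ)

lemma isFactor_hessian_loss (hW : ∀ i j, Measurable fun x => W x i j)
    (hlam : Measurable fun p : (ℕ → Vec d) × Θ => lam p.1 p.2)
    (hcd : ∀ t, ∀ᵐ ω ∂μ, ContDiffOn ℝ 2 (condMean Y lam t ω) (interior Θ))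
    (hθ : θ ∈ interior Θ) (i j : Fin m) :
    IsFactor μ (history Y) fun t ω => hessian (loss Y lam W t ω) θ i j := by
  refine IsFactor.fderiv_apply (F := fun t ω θ' => fderiv ℝ (loss Y lam W t ω) θ' (stdVec j))
    (S := interior Θ) (fun θ hθ => isFactor_fderiv_loss hW hlam hcd hθ _)
    (by rwa [interior_interior]) (fun t => ?_) (stdVec i)
  filter_upwards [hcd t] with ω hω
  exact ((contDiffOn_fderiv_loss isOpen_interior hω _).differentiableOn (by norm_num)).differentiableAt
    (isOpen_interior.mem_nhds hθ)

lemma isFactor_jacobian (hlam : Measurable fun p : (ℕ → Vec d) × Θ => lam p.1 p.2)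
    (hcd : ∀ t, ∀ᵐ ω ∂μ, ContDiffOn ℝ 2 (condMean Y lam t ω) (interior Θ))
    (hθ : θ ∈ interior Θ) :
    IsFactor μ (past Y) fun t ω (p : Fin d × Fin m) =>
      jacobian (condMean Y lam t ω) θ p.1 p.2 := by
  refine IsFactor.pi fun p => ?_
  refine (IsFactor.fderiv_apply (S := Θ) (F := condMean Y lam)
    (fun θ hθ => isFactor_condMean hlam hθ) hθ (fun t => ?_) (stdVec p.2)).comp
    (g := fun v : Vec d => v p.1) (by fun_prop)
  filter_upwards [hcd t] with ω hω
  exact (hω.differentiableOn (by norm_num)).differentiableAt (isOpen_interior.mem_nhds hθ)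

end MWLSE

namespace MWLSE

/-! ### Asymptotic normality of the score -/

variable {Ω : Type*} {d m : ℕ} {Y : ℤ → Ω → Vec d}
  {lam : (ℕ → Vec d) → Vec m → Vec d} {W : (ℕ → Vec d) → Matrix (Fin d) (Fin d) ℝ}
  {Θ : Set (Vec m)} {θ θ₀ : Vec m}

lemma dotProduct_score (a : Fin m → ℝ) (t : ℤ) (ω : Ω) :
    a ⬝ᵥ score Y lam W t ω θ = inner ℝ (mulVecLp (weight Y W t ω).transpose
      (mulVecLp (jacobian (condMean Y lam t ω) θ) (WithLp.toLp 2 a)))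
      (Y t ω - condMean Y lam t ω θ) := by
  rw [inner_mulVecLp]
  simp only [mulVecLp, score]
  rw [Matrix.mulVec_transpose, Matrix.mulVec_transpose, dotProduct_comm,
    ← Matrix.dotProduct_mulVec, dotProduct_comm (Y t ω - condMean Y lam t ω θ).ofLp,
    ← Matrix.dotProduct_mulVec, dotProduct_comm]

lemma sq_dotProduct (a s : Fin m → ℝ) :
    (a ⬝ᵥ s) ^ 2 = ∑ i, ∑ j, a i * a j * (s i * s j) := by
  rw [sq, dotProduct, Finset.sum_mul_sum]
  exact Finset.sum_congr rfl fun i _ => Finset.sum_congr rfl fun j _ => by ring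

variable [mΩ : MeasurableSpace Ω] {μ : Measure Ω}

/-- The natural filtration of the process from time `0` on. -/
def naturalFiltration (hY : ∀ t, Measurable (Y t)) : Filtration ℕ mΩ where
  seq k := sigmaField Y k
  mono' k l hkl := iSup_le fun s => le_iSup
    (fun s : {s : ℤ // s ≤ (l : ℤ)} => MeasurableSpace.comap (Y s) inferInstance)
    ⟨s, s.2.trans (by exact_mod_cast hkl)⟩
  le' k := sigmaField_le hY k

lemma isFactor_score (hW : ∀ i j, Measurable fun x => W x i j)
    (hlam : Measurable fun p : (ℕ → Vec d) × Θ => lam p.1 p.2)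
    (hcd : ∀ t, ∀ᵐ ω ∂μ, ContDiffOn ℝ 2 (condMean Y lam t ω) (interior Θ))
    (hθ : θ ∈ interior Θ) :
    IsFactor μ (history Y) fun t ω => score Y lam W t ω θ := by
  have h := ((isFactor_self (μ := μ) (Y := Y)).prodMk (isFactor_history_of_past
    (((isFactor_condMean hlam (interior_subset hθ)).prodMk (isFactor_weight hW)).prodMk
      (isFactor_jacobian hlam hcd hθ)))).comp
    (g := fun p : Vec d × ((Vec d × (Fin d × Fin d → ℝ)) × (Fin d × Fin m → ℝ)) =>
      fun j : Fin m => ∑ i, p.2.2 (i, j) * ∑ k, p.2.1.2 (i, k) * (p.1 k - p.2.1.1 k))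
    (by fun_prop)
  exact h

/-- A linear form of the score is a martingale difference. -/
lemma condExp_dotProduct_score [IsProbabilityMeasure μ] (hY : ∀ t, Measurable (Y t))
    (hYint : ∀ t, Integrable (Y t) μ) (hW : ∀ i j, Measurable fun x => W x i j)
    (hlam : Measurable fun p : (ℕ → Vec d) × Θ => lam p.1 p.2)
    (hcd : ∀ t, ∀ᵐ ω ∂μ, ContDiffOn ℝ 2 (condMean Y lam t ω) (interior Θ))
    (hθ₀ : θ₀ ∈ interior Θ) {t : ℤ}
    (hmean : μ[Y t | sigmaField Y (t - 1)] =ᵐ[μ] fun ω => condMean Y lam t ω θ₀)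
    (a : Fin m → ℝ) (hInt : Integrable (fun ω => a ⬝ᵥ score Y lam W t ω θ₀) μ) :
    μ[fun ω => a ⬝ᵥ score Y lam W t ω θ₀ | sigmaField Y (t - 1)] =ᵐ[μ] 0 := by
  have hA : IsFactor μ (past Y) fun t ω => mulVecLp (weight Y W t ω).transpose
      (mulVecLp (jacobian (condMean Y lam t ω) θ₀) (WithLp.toLp 2 a)) :=
    ((isFactor_weight hW).prodMk (isFactor_jacobian hlam hcd hθ₀)).comp
      (g := fun p : (Fin d × Fin d → ℝ) × (Fin d × Fin m → ℝ) =>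
        WithLp.toLp 2 fun i => ∑ k, p.1 (k, i) * ∑ j, p.2 (k, j) * a j) (by fun_prop)
  simp only [dotProduct_score] at hInt ⊢
  exact condExp_inner_residual hY hYint hmean (hA.aestronglyMeasurable_sigmaField t) hInt

lemma integrable_sq_dotProduct_score {a : Fin m → ℝ}
    (hI : ∀ i j, Integrable (fun ω => score Y lam W 1 ω θ₀ i * score Y lam W 1 ω θ₀ j) μ) :
    Integrable (fun ω => (a ⬝ᵥ score Y lam W 1 ω θ₀) ^ 2) μ := by
  simp only [sq_dotProduct]
  exact integrable_finsetSum _ fun i _ => integrable_finsetSum _ fun j _ => (hI i j).const_mul _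

lemma integral_sq_dotProduct_score {a : Fin m → ℝ}
    (hI : ∀ i j, Integrable (fun ω => score Y lam W 1 ω θ₀ i * score Y lam W 1 ω θ₀ j) μ) :
    ∫ ω, (a ⬝ᵥ score Y lam W 1 ω θ₀) ^ 2 ∂μ = a ⬝ᵥ (matI μ Y lam W θ₀).mulVec a := by
  simp only [sq_dotProduct]
  rw [integral_finsetSum _ fun i _ => integrable_finsetSum _ fun j _ => (hI i j).const_mul _]
  simp only [dotProduct, Matrix.mulVec, Finset.mul_sum]
  refine Finset.sum_congr rfl fun i _ => ?_
  rw [integral_finsetSum _ fun j _ => (hI i j).const_mul _]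
  refine Finset.sum_congr rfl fun j _ => ?_
  rw [integral_const_mul, matI, Matrix.of_apply]
  ring

lemma posSemidef_matI
    (hI : ∀ i j, Integrable (fun ω => score Y lam W 1 ω θ₀ i * score Y lam W 1 ω θ₀ j) μ) :
    (matI μ Y lam W θ₀).PosSemidef := by
  refine Matrix.PosSemidef.of_dotProduct_mulVec_nonneg ?_ fun a => ?_
  · ext i j
    simp [matI, mul_comm]
  · rw [star_trivial, ← integral_sq_dotProduct_score hI]
    exact integral_nonneg fun ω => sq_nonneg _

/-- Central limit theorem for linear forms of the score. -/
lemma tendsto_integral_exp_score [IsProbabilityMeasure μ] (hY : ∀ t, Measurable (Y t))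
    (hE : StationaryErgodic μ Y)
    (hYint : ∀ t, Integrable (Y t) μ) (hW : ∀ i j, Measurable fun x => W x i j)
    (hlam : Measurable fun p : (ℕ → Vec d) × Θ => lam p.1 p.2)
    (hcd : ∀ t, ∀ᵐ ω ∂μ, ContDiffOn ℝ 2 (condMean Y lam t ω) (interior Θ))
    (hθ₀ : θ₀ ∈ interior Θ)
    (hmean : ∀ t, μ[Y t | sigmaField Y (t - 1)] =ᵐ[μ] fun ω => condMean Y lam t ω θ₀)
    (hI : ∀ i j, Integrable (fun ω => score Y lam W 1 ω θ₀ i * score Y lam W 1 ω θ₀ j) μ)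
    (a : Fin m → ℝ) :
    Tendsto (fun T : ℕ => ∫ ω, Complex.exp (Complex.I * (((√(T : ℝ))⁻¹ *
        ∑ t ∈ Finset.Icc 1 T, a ⬝ᵥ score Y lam W t ω θ₀ : ℝ) : ℂ)) ∂μ) atTop
      (𝓝 ((Real.exp (-(a ⬝ᵥ (matI μ Y lam W θ₀).mulVec a) / 2) : ℝ) : ℂ)) := by
  set Z : ℤ → Ω → ℝ := fun t ω => a ⬝ᵥ score Y lam W t ω θ₀ with hZdef
  have hZ : IsFactor μ (history Y) Z := (isFactor_score hW hlam hcd hθ₀).comp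
    (g := fun s : Fin m → ℝ => a ⬝ᵥ s) (by simp only [dotProduct]; fun_prop)
  have hZsq : IsFactor μ (history Y) fun t ω => Z t ω ^ 2 :=
    hZ.comp (g := fun s : ℝ => s ^ 2) (by fun_prop)
  have hZ1 : Integrable (fun ω => Z 1 ω ^ 2) μ := integrable_sq_dotProduct_score hI
  have hZk : ∀ k : ℕ, Integrable (fun ω => Z (k + 1) ω ^ 2) μ := fun k =>
    (hZsq.identDistrib hY hE k).integrable_iff.2 hZ1
  have hZi : ∀ k : ℕ, Integrable (Z (k + 1)) μ := fun k =>
    ((memLp_two_iff_integrable_sq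
      (hZ.aemeasurable (measurable_history hY _)).aestronglyMeasurable).2 (hZk k)).integrable
      one_le_two
  have hlln := hZsq.ae_tendsto_average hY hE hZ1
  have hv : ∀ k : ℕ, ∫ ω, Z (k + 1) ω ^ 2 ∂μ = a ⬝ᵥ (matI μ Y lam W θ₀).mulVec a := fun k =>
    (hZsq.identDistrib hY hE k).integral_eq.trans (integral_sq_dotProduct_score hI)
  have hmd : ∀ k : ℕ, μ[Z (k + 1) | sigmaField Y (k : ℤ)] =ᵐ[μ] 0 := fun k => by
    have := condExp_dotProduct_score (t := (k : ℤ) + 1) hY hYint hW hlam hcd hθ₀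
      (hmean _) a (hZi k)
    rwa [add_sub_cancel_right] at this
  obtain ⟨q, hq, h⟩ := hZ
  set x : ℕ → Ω → ℝ := fun k ω => q (history Y (k + 1) ω) with hx
  have hxZ : ∀ k : ℕ, Z (k + 1) =ᵐ[μ] x k := fun k => h (k + 1)
  have hsq : ∀ k : ℕ, (fun ω => Z (k + 1) ω ^ 2) =ᵐ[μ] fun ω => x k ω ^ 2 := fun k =>
    (hxZ k).fun_comp (· ^ 2)
  have hxm : ∀ k, StronglyMeasurable[naturalFiltration hY (k + 1)] (x k) := fun k => by
    have hp := past_measurable_sigmaField (Y := Y) ((k : ℤ) + 1 + 1)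
    rw [add_sub_cancel_right] at hp
    have e : naturalFiltration hY (k + 1) = sigmaField Y ((k : ℤ) + 1) := by
      change sigmaField Y ((k + 1 : ℕ) : ℤ) = _
      push_cast
      rfl
    rw [e]
    exact (hq.comp hp).stronglyMeasurable
  have hall : ∀ᵐ ω ∂μ, ∀ k : ℕ, Z (k + 1) ω = x k ω := ae_all_iff.2 hxZ
  have key := MartingaleCLT.tendsto_integral_exp_sum (μ := μ) (ℱ := naturalFiltration hY) (x := x)
    (v := a ⬝ᵥ (matI μ Y lam W θ₀).mulVec a) hxm (fun k => (hZk k).congr (hsq k))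
    (fun k => (condExp_congr_ae (hxZ k).symm).trans (hmd k))
    (fun k => (integral_congr_ae (hsq k)).symm.trans (hv k)) ?_
  · refine key.congr fun T => integral_congr_ae ?_
    filter_upwards [hall] with ω hω
    rw [sum_Icc_one_eq_sum_range (fun t => Z t ω)]
    push_cast
    simp only [hω]
  · filter_upwards [hlln, hall] with ω h1 h2
    have e : ∫ ω, Z 1 ω ^ 2 ∂μ = a ⬝ᵥ (matI μ Y lam W θ₀).mulVec a := integral_sq_dotProduct_score hI
    rw [e] at h1
    refine h1.congr fun T => ?_
    rw [sum_Icc_one_eq_sum_range (fun t => Z t ω ^ 2)]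
    push_cast
    simp only [h2]

/-! ### Linearization of the first-order condition -/

/-- The average score is asymptotically linear in the estimation error. -/
lemma ae_eventually_average_score_sub_le [IsProbabilityMeasure μ] (hY : ∀ t, Measurable (Y t))
    (hE : StationaryErgodic μ Y) (hW : ∀ i j, Measurable fun x => W x i j)
    (hlam : Measurable fun p : (ℕ → Vec d) × Θ => lam p.1 p.2)
    (hpd : ∀ t, ∀ᵐ ω ∂μ, (weight Y W t ω).PosDef)
    (hcd : ∀ t, ∀ᵐ ω ∂μ, ContDiffOn ℝ 2 (condMean Y lam t ω) (interior Θ))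
    (hdom : ∀ t, ∫⁻ ω, ⨆ θ ∈ interior Θ,
      matSpectralNorm (hessian (loss Y lam W t ω) θ) ∂μ < ⊤)
    (hθ₀ : θ₀ ∈ interior Θ) (hH : (matH μ Y lam W θ₀).IsHermitian) {θhat : ℕ → Ω → Vec m}
    (hmin : ∀ T, 1 ≤ T → ∀ᵐ ω ∂μ, IsMinOn (objective Y lam W T ω) Θ (θhat T ω))
    (hcons : ∀ᵐ ω ∂μ, Tendsto (fun T => θhat T ω) atTop (𝓝 θ₀)) :
    ∀ᵐ ω ∂μ, ∀ ε > 0, ∀ᶠ T : ℕ in atTop,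
      ‖(T : ℝ)⁻¹ • ∑ t ∈ Finset.Icc 1 T, (WithLp.toLp 2 (score Y lam W t ω θ₀) : Vec m)
        - mulVecLp (matH μ Y lam W θ₀) (θhat T ω - θ₀)‖ ≤ ε * ‖θhat T ω - θ₀‖ := by
  have hloc : ∀ (n : ℕ) (i j : Fin m), ∃ r > 0, ∀ᵐ ω ∂μ, ∀ᶠ T : ℕ in atTop, ∀ θ ∈ interior Θ,
      dist θ θ₀ < r → |(T : ℝ)⁻¹ * ∑ t ∈ Finset.Icc 1 T, hessian (loss Y lam W t ω) θ i j
        - ∫ ω, hessian (loss Y lam W 1 ω) θ₀ i j ∂μ| ≤ 1 / ((n : ℝ) + 1) := fun n i j => by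
    refine exists_pos_ae_eventually_average_close hY hE
      (F := fun t ω θ => hessian (loss Y lam W t ω) θ i j)
      (fun θ hθ => isFactor_hessian_loss hW hlam hcd hθ i j)
      (fun t => (hcd t).mono fun ω hω => continuousOn_hessian_loss isOpen_interior hω i j)
      (fun t => (lintegral_mono fun ω => ?_).trans_lt (hdom t)) hθ₀ Nat.one_div_pos_of_nat
    exact iSup₂_mono fun θ _ => enorm_apply_le_matSpectralNorm _ i j
  choose r hr hav using hloc
  have hmin' : ∀ᵐ ω ∂μ, ∀ T, 1 ≤ T → IsMinOn (objective Y lam W T ω) Θ (θhat T ω) := by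
    simpa only [ae_all_iff] using hmin
  have hav' : ∀ᵐ ω ∂μ, ∀ n i j, ∀ᶠ T : ℕ in atTop, ∀ θ ∈ interior Θ,
      dist θ θ₀ < r n i j → |(T : ℝ)⁻¹ * ∑ t ∈ Finset.Icc 1 T, hessian (loss Y lam W t ω) θ i j
        - ∫ ω, hessian (loss Y lam W 1 ω) θ₀ i j ∂μ| ≤ 1 / ((n : ℝ) + 1) := by
    simpa only [ae_all_iff] using hav
  filter_upwards [hcons, hmin', hav', ae_all_iff.2 hcd, ae_all_iff.2 hpd] with ω h1 h2 h3 h4 h5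
  intro ε hε
  obtain ⟨n, hn⟩ := exists_nat_one_div_lt (show 0 < ε / ((m : ℝ) * m + 1) by positivity)
  set η : ℝ := 1 / ((n : ℝ) + 1) with hη
  have hη0 : 0 < η := Nat.one_div_pos_of_nat
  have hnhds : ∀ᶠ x in 𝓝 θ₀, x ∈ interior Θ ∧ ∀ i j, dist x θ₀ < r n i j :=
    (isOpen_interior.eventually_mem hθ₀).and (eventually_all.2 fun i => eventually_all.2 fun j =>
      Metric.ball_mem_nhds θ₀ (hr n i j))
  obtain ⟨ρ, hρ, hball⟩ := Metric.eventually_nhds_iff_ball.1 hnhds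
  filter_upwards [h1.eventually_mem (Metric.ball_mem_nhds θ₀ hρ),
    eventually_all.2 fun i => eventually_all.2 fun j => h3 n i j, eventually_ge_atTop 1]
    with T hT1 hT2 hT3
  set v := θhat T ω - θ₀ with hv
  have hdl : ∀ (t : ℤ) (x : Vec m), x ∈ interior Θ → DifferentiableAt ℝ (loss Y lam W t ω) x :=
    fun t x hx => ((contDiffOn_loss (h4 t)).differentiableOn (by norm_num)).differentiableAt
      (isOpen_interior.mem_nhds hx)
  have hdd : ∀ (t : ℤ) (j : Fin m) (x : Vec m), x ∈ interior Θ →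
      DifferentiableAt ℝ (fun θ => fderiv ℝ (loss Y lam W t ω) θ (stdVec j)) x :=
    fun t j x hx => ((contDiffOn_fderiv_loss isOpen_interior (h4 t) _).differentiableOn
      (by norm_num)).differentiableAt (isOpen_interior.mem_nhds hx)
  have hentry : ∀ j, |(T : ℝ)⁻¹ * ∑ t ∈ Finset.Icc 1 T, score Y lam W t ω θ₀ j
      - ∑ i, v i * matH μ Y lam W θ₀ i j| ≤ m * η * ‖v‖ := by
    intro j
    set f : Vec m → ℝ := fun θ =>
      (T : ℝ)⁻¹ * ∑ t ∈ Finset.Icc 1 T, fderiv ℝ (loss Y lam W t ω) θ (stdVec j) with hf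
    have hfd : ∀ x ∈ interior Θ, HasFDerivAt f ((T : ℝ)⁻¹ • ∑ t ∈ Finset.Icc 1 T,
        fderiv ℝ (fun θ => fderiv ℝ (loss Y lam W t ω) θ (stdVec j)) x) x := fun x hx =>
      (HasFDerivAt.fun_sum fun (t : ℕ) _ => (hdd t j x hx).hasFDerivAt).const_mul _
    have hmv := abs_sub_sub_le_of_fderiv_close (f := f) (θ₀ := θ₀) (θ := θhat T ω) (r := ρ)
      (η := η) hη0.le (c := fun i => ∫ ω, hessian (loss Y lam W 1 ω) θ₀ i j ∂μ)
      (fun x hx => (hfd x (hball x hx).1).differentiableAt)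
      (fun x hx i => by
        rw [(hfd x (hball x hx).1).fderiv]
        simpa [hessian, hη] using hT2 i j x (hball x hx).1
          ((hball x hx).2 i j)) hT1
    have hzero : f (θhat T ω) = 0 := by
      have hloc : IsLocalMin (objective Y lam W T ω) (θhat T ω) :=
        (h2 T hT3).isLocalMin (mem_interior_iff_mem_nhds.1 (hball _ hT1).1)
      have hobj : HasFDerivAt (objective Y lam W T ω) ((T : ℝ)⁻¹ • ∑ t ∈ Finset.Icc 1 T,
          fderiv ℝ (loss Y lam W t ω) (θhat T ω)) (θhat T ω) :=
        (HasFDerivAt.fun_sum fun (t : ℕ) _ => (hdl t _ (hball _ hT1).1).hasFDerivAt).const_mul _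
      have := hobj.fderiv.symm.trans hloc.fderiv_eq_zero
      have := congrArg (fun A : Vec m →L[ℝ] ℝ => A (stdVec j)) this
      simpa [hf] using this
    have hstart : f θ₀ = -2 * ((T : ℝ)⁻¹ * ∑ t ∈ Finset.Icc 1 T, score Y lam W t ω θ₀ j) := by
      simp only [hf]
      rw [Finset.sum_congr rfl fun (t : ℕ) _ => fderiv_loss_stdVec (h5 t).isHermitian
        (((h4 t).differentiableOn (by norm_num)).differentiableAt
          (isOpen_interior.mem_nhds hθ₀)) j, ← Finset.mul_sum]
      ring
    have hsum : ∑ i, v i * ∫ ω, hessian (loss Y lam W 1 ω) θ₀ i j ∂μ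
        = 2 * ∑ i, v i * matH μ Y lam W θ₀ i j := by
      rw [Finset.mul_sum]
      refine Finset.sum_congr rfl fun i _ => ?_
      rw [matH, Matrix.of_apply, integral_const_mul]
      ring
    rw [hzero, hstart, hsum] at hmv
    have e : 0 - -2 * ((T : ℝ)⁻¹ * ∑ t ∈ Finset.Icc 1 T, score Y lam W t ω θ₀ j)
        - 2 * ∑ i, v i * matH μ Y lam W θ₀ i j
        = 2 * ((T : ℝ)⁻¹ * ∑ t ∈ Finset.Icc 1 T, score Y lam W t ω θ₀ j
        - ∑ i, v i * matH μ Y lam W θ₀ i j) := by ring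
    rw [e, abs_mul, abs_two] at hmv
    linarith [abs_nonneg ((T : ℝ)⁻¹ * ∑ t ∈ Finset.Icc 1 T, score Y lam W t ω θ₀ j
        - ∑ i, v i * matH μ Y lam W θ₀ i j)]
  refine (norm_le_of_abs_apply_le (c := m * η * ‖v‖) fun j => ?_).trans ?_
  · have hHs : ∀ i, matH μ Y lam W θ₀ j i = matH μ Y lam W θ₀ i j := fun i => by
      simpa using hH.apply i j
    convert! hentry j using 2
    simp [mulVecLp, Matrix.mulVec, dotProduct, hHs, mul_comm]
  · have : (m : ℝ) * m * η ≤ ε := by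
      have h6 : (m : ℝ) * m * η ≤ (m * m + 1) * η := by nlinarith
      rw [lt_div_iff₀ (by positivity)] at hn
      linarith
    calc (m : ℝ) * (m * η * ‖v‖) = (m * m * η) * ‖v‖ := by ring
      _ ≤ ε * ‖v‖ := by gcongr

end MWLSE

theorem theorem1 {Ω : Type*} [MeasurableSpace Ω] (μ : Measure Ω) [IsProbabilityMeasure μ]
    {d m : ℕ}
    -- the process, the conditional mean function, the weight function, the parameter space
    (Y : ℤ → Ω → MWLSE.Vec d) (hY : ∀ t, Measurable (Y t))
    (lam : (ℕ → MWLSE.Vec d) → MWLSE.Vec m → MWLSE.Vec d)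
    (W : (ℕ → MWLSE.Vec d) → Matrix (Fin d) (Fin d) ℝ)
    (hW : ∀ i j, Measurable fun x => W x i j)
    (Θ : Set (MWLSE.Vec m)) (θ₀ : MWLSE.Vec m) (hθ₀ : θ₀ ∈ Θ)
    (hlam : Measurable fun p : (ℕ → MWLSE.Vec d) × Θ => lam p.1 p.2)
    -- correctly specified conditional mean
    (hYint : ∀ t, Integrable (Y t) μ)
    (hmean : ∀ t, μ[Y t | MWLSE.sigmaField Y (t - 1)] =ᵐ[μ]
      fun ω => MWLSE.condMean Y lam t ω θ₀)
    -- the first-step estimator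
    (θhat : ℕ → Ω → MWLSE.Vec m) (hθhat : MWLSE.IsFirstStepEstimator μ Y lam W Θ θhat)
    -- A1
    (A1 : MWLSE.StationaryErgodic μ Y)
    -- A2
    (A2_cont : ∀ t, ∀ᵐ ω ∂μ, ContinuousOn (MWLSE.condMean Y lam t ω) Θ)
    (A2_compact : IsCompact Θ)
    (A2_moment : ∀ t, ∫⁻ ω, ⨆ θ ∈ Θ, ‖MWLSE.loss Y lam W t ω θ‖ₑ ∂μ < ⊤)
    -- A3
    (A3 : ∀ t, ∀ᵐ ω ∂μ, (MWLSE.weight Y W t ω).PosDef)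
    -- A4
    (A4 : ∀ t, ∀ θ ∈ Θ,
      (∀ᵐ ω ∂μ, MWLSE.condMean Y lam t ω θ = MWLSE.condMean Y lam t ω θ₀) ↔ θ = θ₀) :
    -- strong consistency
    (∀ᵐ ω ∂μ, Tendsto (fun T => θhat T ω) atTop (𝓝 θ₀)) ∧
    -- asymptotic normality under the additional conditions A5, A6, A7
    -- A5
    ((∀ i j, Integrable (fun ω => MWLSE.hessian (MWLSE.loss Y lam W 1 ω) θ₀ i j) μ) →
      (∀ i j, Integrable
        (fun ω => MWLSE.score Y lam W 1 ω θ₀ i * MWLSE.score Y lam W 1 ω θ₀ j) μ) →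
      (MWLSE.matH μ Y lam W θ₀).PosDef →
      -- A6
      (∀ t, ∀ᵐ ω ∂μ, ContDiffOn ℝ 2 (MWLSE.condMean Y lam t ω) (interior Θ)) →
      (∀ t, ∫⁻ ω, ⨆ θ ∈ interior Θ,
        MWLSE.matSpectralNorm (MWLSE.hessian (MWLSE.loss Y lam W t ω) θ) ∂μ < ⊤) →
      -- A7
      θ₀ ∈ interior Θ →
      TendstoInDistribution (fun (T : ℕ) ω => √(T : ℝ) • (θhat T ω - θ₀)) atTop id
        (fun _ => μ)
        (multivariateGaussian (0 : MWLSE.Vec m)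
          ((MWLSE.matH μ Y lam W θ₀)⁻¹ * MWLSE.matI μ Y lam W θ₀ *
            (MWLSE.matH μ Y lam W θ₀)⁻¹))) := by
  have hcons : ∀ᵐ ω ∂μ, Tendsto (fun T => θhat T ω) atTop (𝓝 θ₀) := by
    refine MWLSE.ae_tendsto_of_average_le hY A1 A2_compact
      (fun θ hθ => MWLSE.isFactor_loss hW hlam hθ)
      (fun t => (A2_cont t).mono fun ω hω => MWLSE.continuousOn_loss hω) A2_moment hθ₀
      (fun θ hθ hne => ?_) hθhat.mem fun T hT => ?_
    · exact MWLSE.integral_loss_lt hY hYint hW hlam (hmean 1) (A2_moment 1) (A3 1) hθ₀ hθ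
        fun h => hne ((A4 1 θ hθ).1 h)
    · filter_upwards [hθhat.isMinOn T hT] with ω hω
      exact hω hθ₀
  refine ⟨hcons, fun _ hI hH hcd hdom hInt => ?_⟩
  set H := MWLSE.matH μ Y lam W θ₀ with hHdef
  set s : ℤ → Ω → MWLSE.Vec m := fun t ω => WithLp.toLp 2 (MWLSE.score Y lam W t ω θ₀) with hs
  set S : ℕ → Ω → MWLSE.Vec m := fun T ω => (√(T : ℝ))⁻¹ • ∑ t ∈ Finset.Icc 1 T, s t ω with hS
  have hHinv : (H⁻¹).IsHermitian := hH.inv.isHermitian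
  have hHH : H⁻¹ * H = 1 := Matrix.nonsing_inv_mul _ ((Matrix.isUnit_iff_isUnit_det H).1 hH.isUnit)
  have hpsd : (H⁻¹ * MWLSE.matI μ Y lam W θ₀ * H⁻¹).PosSemidef := by
    have := (MWLSE.posSemidef_matI hI).conjTranspose_mul_mul_same H⁻¹
    rwa [hHinv.eq] at this
  set L := Matrix.toEuclideanCLM (n := Fin m) (𝕜 := ℝ) H⁻¹ with hL
  have hsm : ∀ t, AEMeasurable (s t) μ := fun t =>
    ((MWLSE.isFactor_score hW hlam hcd hInt).comp
      (g := fun a : Fin m → ℝ => (WithLp.toLp 2 a : MWLSE.Vec m)) (by fun_prop)).aemeasurable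
      (MWLSE.measurable_history hY t)
  have hSm : ∀ T, AEMeasurable (S T) μ := fun T =>
    (Finset.aemeasurable_fun_sum (Finset.Icc 1 T) fun (t : ℕ) _ => hsm t).const_smul (√(T : ℝ))⁻¹
  refine MWLSE.tendstoInDistribution_of_charFun_of_relative_error (N := fun T ω => L (S T ω))
    (fun T => L.measurable.comp_aemeasurable (hSm T)) (fun T => ?_) (fun u => ?_) ?_
  · rcases Nat.eq_zero_or_pos T with rfl | hT
    · simp
    · exact ((hθhat.aemeasurable T hT).sub_const θ₀).const_smul √(T : ℝ)
  · set a : Fin m → ℝ := H⁻¹.mulVec u.ofLp with ha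
    have hlin : ∀ T ω, inner ℝ (L (S T ω)) u = (√(T : ℝ))⁻¹ *
        ∑ t ∈ Finset.Icc 1 T, a ⬝ᵥ MWLSE.score Y lam W t ω θ₀ := fun T ω => by
      rw [real_inner_comm, hL, Matrix.inner_toEuclideanCLM,
        MWLSE.dotProduct_mulVec_comm hHinv, dotProduct_comm, ← ha]
      simp only [hS, hs, WithLp.ofLp_smul, WithLp.ofLp_sum, dotProduct_smul, smul_eq_mul,
        dotProduct_sum]
    have hlim := MWLSE.tendsto_integral_exp_score hY A1 hYint hW hlam hcd hInt hmean hI a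
    have hval : charFun (multivariateGaussian (0 : MWLSE.Vec m)
        (H⁻¹ * MWLSE.matI μ Y lam W θ₀ * H⁻¹)) u
        = ((Real.exp (-(a ⬝ᵥ (MWLSE.matI μ Y lam W θ₀).mulVec a) / 2) : ℝ) : ℂ) := by
      rw [charFun_multivariateGaussian hpsd, inner_zero_right, ← Matrix.mulVec_mulVec,
        ← Matrix.mulVec_mulVec, ← ha, MWLSE.dotProduct_mulVec_comm hHinv, ← ha, dotProduct_comm]
      push_cast
      congr 1
      ring
    rw [hval]
    refine hlim.congr fun T => ?_
    have hLS : AEMeasurable (fun ω => L (S T ω)) μ := L.measurable.comp_aemeasurable (hSm T)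
    rw [charFun_apply, integral_map hLS (by fun_prop)]
    refine integral_congr_ae (.of_forall fun ω => ?_)
    simp only [hlin]
    rw [mul_comm]
  · filter_upwards [MWLSE.ae_eventually_average_score_sub_le hY A1 hW hlam A3 hcd hdom hInt
      hH.isHermitian hθhat.isMinOn hcons] with ω hω ε hε
    filter_upwards [hω (ε / (‖L‖ + 1)) (by positivity), eventually_ge_atTop 1] with T hT hT1
    have hTpos : (0 : ℝ) < T := by exact_mod_cast hT1
    have hsq : √(T : ℝ) * (T : ℝ)⁻¹ = (√(T : ℝ))⁻¹ := by
      rw [← Real.sqrt_inv, ← div_eq_mul_inv, Real.sqrt_div_self', Real.sqrt_inv, one_div]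
    have hLH : ∀ v : MWLSE.Vec m, L (MWLSE.mulVecLp H v) = v := fun v => by
      rw [hL, MWLSE.mulVecLp, Matrix.toEuclideanCLM_toLp, Matrix.mulVec_mulVec, hHH,
        Matrix.one_mulVec]
    have hdiff : L (S T ω) - √(T : ℝ) • (θhat T ω - θ₀) = √(T : ℝ) • L ((T : ℝ)⁻¹ •
        ∑ t ∈ Finset.Icc 1 T, s t ω - MWLSE.mulVecLp H (θhat T ω - θ₀)) := by
      rw [map_sub, hLH, smul_sub √(T : ℝ) (L _), ← map_smul, smul_smul, hsq]
    rw [hdiff, norm_smul, norm_smul]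
    calc ‖√(T : ℝ)‖ * ‖L ((T : ℝ)⁻¹ • ∑ t ∈ Finset.Icc 1 T, s t ω
          - MWLSE.mulVecLp H (θhat T ω - θ₀))‖
        ≤ ‖√(T : ℝ)‖ * ((‖L‖ + 1) * (ε / (‖L‖ + 1) * ‖θhat T ω - θ₀‖)) := by
          gcongr
          refine (L.le_opNorm _).trans ?_
          gcongr
          linarith
      _ = ε * (‖√(T : ℝ)‖ * ‖θhat T ω - θ₀‖) := by
          field_simp
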